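/- Let $k$ be a field, $n\ge 1$, $\Lambda_n=k[x]/(x^n)$, and let $[i]=\Lambda_n/(x^i)$ for $0\le i\le n$. Let $E=\bigoplus_{i=1}^n[i]$ and let $A_n=\operatorname{End}_{\Lambda_n}(E)^{\mathrm{op}}$ be the Auslander algebra of $\Lambda_n$. Put $P_A(i)=\operatorname{Hom}_{\Lambda_n}(E,[i])$, a left $A_n$-module (projective, with $P_A(0)=0$), so that the inclusions $[i]\subset[n]$ give $P_A(i)\subset P_A(n)$; put $T(i)=P_A(n)/P_A(i-1)$ for $1\le i\le n$ and $T=\bigoplus_{i=1}^nT(i)$ (the characteristic tilting module). Let $e(i)\in A_n$ be the idempotent $E\to[i]\to E$. Let $\operatorname{mod}$ denote the category of left modules of finite length, and let $\mathcal F(n)$ be the full subcategory of $\operatorname{mod}A_n$ given by the torsionless modules. Then: (a) Let $\Pi_{n-1}$ be the preprojective algebra of type $\mathbb A_{n-1}$ over $k$, with $\Pi_0=0$. There is an isomorphism of $k$-algebras $\Pi_{n-1}\cong A_n/\langle e(n)\rangle$ sending the $i$-th vertex idempotent $e_i$ to the class of $e(i)$ for $1\le i\le n-1$, and, for $1\le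 i\le n-2$, the arrow $i\to i+1$ to the class of the inclusion $[i]\to[i+1]$ and the opposite arrow $i+1\to i$ to the class of the projection $[i+1]\to[i]$ (maps between summands of $E$ being regarded as elements of $A_n$). It is used to identify the two algebras. (b) For an $A_n$-module $M$ let $tM$ be the largest submodule of $M$ generated by $P_A(n)$, that is, the sum of the images of all homomorphisms $P_A(n)\to M$. Then $\delta M=M/tM$ is annihilated by $e(n)$, hence is a $\Pi_{n-1}$-module. The module $T$ belongs to $\mathcal F(n)$, and the functor $\delta:\mathcal F(n)\to\operatorname{mod}\Pi_{n-1}$ vanishes on the ideal $\langle T\rangle$ of all morphisms of $\mathcal F(n)$ which factor through a finite direct sum of copies of $T$, and the induced functor $$\mathcal F(n)/T=\mathcal F(n)/\langle T\rangle\longrightarrow\operatorname{mod}\Pi_{n-1}$$ is an equivalence of categories. (c) For $1\le j\le n-1$ the module $P_A(j)$ belongs to $\mathcal F(n)$, and $\delta(P_A(j))\cong P_\Pi(j)$, where $P_\Pi(j)=\Pi_{n-1}e_j$ is the indecomposable projective $\Pi_{n-1}$-module at the vertex $j$. -/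

import Mathlib

open CategoryTheory CategoryTheory.Limits

universe u

noncomputable section

namespace PreprojQuot

/-! ### Factor categories -/

section FactorCategory

variable {C : Type*} [Category* C]

/-- `Z` is a (finite) direct sum of objects belonging to the class `K`. -/
def IsDirectSumOf [HasZeroMorphisms C] (K : ObjectProperty C) (Z : C) : Prop :=
  ∃ (r : ℕ) (Y : Fin r → C) (b : Bicone Y),
    (∀ i, K (Y i)) ∧ Nonempty b.IsBilimit ∧ b.pt = Z

/-- The ideal `⟨K⟩` of an additive category: the morphisms which factor through a direct sum of
objects in `K`. -/
def InIdeal [HasZeroMorphisms C] (K : ObjectProperty C) {X Y : C} (f : X ⟶ Y) : Prop :=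
  ∃ (Z : C) (g : X ⟶ Z) (h : Z ⟶ Y), IsDirectSumOf K Z ∧ g ≫ h = f

/-- Two parallel morphisms are identified modulo `⟨K⟩` if their difference lies in `⟨K⟩`. -/
def idealRel [Preadditive C] (K : ObjectProperty C) : HomRel C :=
  fun _ _ f g ↦ InIdeal K (f - g)

/-- The factor category `C / K`: same objects, and morphisms are the residue classes modulo the
ideal `⟨K⟩`. -/
abbrev FactorCategory [Preadditive C] (K : ObjectProperty C) :=
  CategoryTheory.Quotient (idealRel K)

end FactorCategory

/-! ### Modules -/

/-- The modules of finite length, as a property of objects of the category of modules. -/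
def finLen (R : Type u) [Ring R] : ObjectProperty (ModuleCat.{u} R) :=
  fun M ↦ IsFiniteLength R M

/-- `mod R`: the category of (left) `R`-modules of finite length. -/
abbrev FinMod (R : Type u) [Ring R] := (finLen R).FullSubcategory

/-- A module `M` is torsionless if its elements are separated by the linear maps `M → R`. -/
def IsTorsionless (R M : Type*) [Ring R] [AddCommGroup M] [Module R M] : Prop :=
  ∀ m : M, m ≠ 0 → ∃ f : M →ₗ[R] R, f m ≠ 0

/-- Finite length passes along a surjective map `g` which is semilinear with respect to a ring
homomorphism `σ`. -/
theorem isFiniteLength_of_semilinear {R S M N : Type*} [Ring R] [Ring S] [AddCommGroup M]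
    [AddCommGroup N] [Module R M] [Module S N] (σ : R →+* S) (g : M →+ N)
    (hg : Function.Surjective g) (hs : ∀ (r : R) (m : M), g (r • m) = σ r • g m)
    (h : IsFiniteLength R M) : IsFiniteLength S N := by
  let F : Submodule S N ↪o Submodule R M :=
    OrderEmbedding.ofMapLEIff
      (fun p ↦ { p.toAddSubmonoid.comap g with
                  smul_mem' := fun r m hm ↦ by
                    change g (r • m) ∈ p
                    rw [hs]
                    exact p.smul_mem _ hm })
      (by
        intro p q
        constructor
        · intro hpq y hy
          obtain ⟨m, rfl⟩ := hg y
          exact hpq (show g m ∈ p from hy)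
        · intro hpq m hm
          exact hpq (show g m ∈ p from hm))
  rw [isFiniteLength_iff_isNoetherian_isArtinian] at h ⊢
  obtain ⟨h1, h2⟩ := h
  constructor
  · rw [isNoetherian_iff'] at h1 ⊢
    exact F.strictMono.wellFoundedGT
  · exact F.strictMono.wellFoundedLT

/-! ### The Auslander algebra of `k[x]/(x^n)` -/

section Auslander

variable (k : Type u) [Field k] (n : ℕ)

/-- `Λ_n = k[x]/(x^n)`. -/
def Lam : Type u := Polynomial k ⧸ Ideal.span {(Polynomial.X : Polynomial k) ^ n}

instance : CommRing (Lam k n) :=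
  inferInstanceAs (CommRing (Polynomial k ⧸ Ideal.span {(Polynomial.X : Polynomial k) ^ n}))

instance : Algebra k (Lam k n) :=
  inferInstanceAs (Algebra k (Polynomial k ⧸ Ideal.span {(Polynomial.X : Polynomial k) ^ n}))

/-- The class of `x` in `Λ_n`. -/
def xbar : Lam k n :=
  Ideal.Quotient.mk (Ideal.span {(Polynomial.X : Polynomial k) ^ n}) Polynomial.X

/-- The `Λ_n`-module `[i] = Λ_n / (x^i)`; for `i ≤ n` it is the indecomposable `Λ_n`-module of
length `i`. -/
abbrev Ind (i : ℕ) : Type u := Lam k n ⧸ Ideal.span {xbar k n ^ i}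

/-- The canonical map `[i] → [j]`: induced by multiplication by `x^(j-i)`, an inclusion, if
`i ≤ j ≤ n`, and the canonical projection if `j ≤ i`. -/
def can (i j : ℕ) : Ind k n i →ₗ[Lam k n] Ind k n j :=
  Submodule.mapQ _ _ (LinearMap.mulLeft (Lam k n) (xbar k n ^ (j - i))) (by
    rw [Ideal.span_le, Set.singleton_subset_iff]
    change xbar k n ^ (j - i) * xbar k n ^ i ∈ Ideal.span {xbar k n ^ j}
    rw [← pow_add, Ideal.mem_span_singleton]
    exact pow_dvd_pow _ (by omega))

/-- `E = [1] ⊕ ⋯ ⊕ [n]`, the minimal Auslander generator; the summand with index `i : Fin n` is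
`[i+1]`. -/
abbrev E : Type u := (i : Fin n) → Ind k n (i + 1)

/-- The Auslander algebra `A_n = End(E)^op`. -/
def A : Type u := (Module.End (Lam k n) (E k n))ᵐᵒᵖ

instance : Ring (A k n) := inferInstanceAs (Ring (Module.End (Lam k n) (E k n))ᵐᵒᵖ)

instance : Algebra k (A k n) := inferInstanceAs (Algebra k (Module.End (Lam k n) (E k n))ᵐᵒᵖ)

variable {k n} in
/-- An endomorphism of `E`, as an element of `A_n`. -/
def A.of (f : E k n →ₗ[Lam k n] E k n) : A k n :=
  MulOpposite.op (f : Module.End (Lam k n) (E k n))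

variable {k n} in
/-- An element of `A_n`, as an endomorphism of `E`. -/
def A.toEnd (a : A k n) : E k n →ₗ[Lam k n] E k n :=
  MulOpposite.unop (a : (Module.End (Lam k n) (E k n))ᵐᵒᵖ)

/-- The element `E → [i+1] → [j+1] → E` of `A_n`, built from the canonical map
`[i+1] → [j+1]`. -/
def arrow (i j : Fin n) : A k n :=
  A.of (LinearMap.single (Lam k n) (fun l : Fin n ↦ Ind k n (l + 1)) j ∘ₗ
    can k n (i + 1) (j + 1) ∘ₗ LinearMap.proj i)

/-- The idempotent `E → [i+1] → E` of `A_n`. -/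
def e (i : Fin n) : A k n :=
  A.of (LinearMap.single (Lam k n) (fun l : Fin n ↦ Ind k n (l + 1)) i ∘ₗ
    LinearMap.proj i)

/-- The group `Hom_Λ(E, X)`, regarded as a left `A_n`-module. -/
def HomE (X : Type u) [AddCommGroup X] [Module (Lam k n) X] : Type u := E k n →ₗ[Lam k n] X

instance (X : Type u) [AddCommGroup X] [Module (Lam k n) X] : AddCommGroup (HomE k n X) :=
  inferInstanceAs (AddCommGroup (E k n →ₗ[Lam k n] X))

/-- `End(E)^op` acts on `Hom_Λ(E, X)` by precomposition. -/
instance (X : Type u) [AddCommGroup X] [Module (Lam k n) X] : Module (A k n) (HomE k n X) where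
  smul a f := LinearMap.comp (f : E k n →ₗ[Lam k n] X) a.toEnd
  one_smul _ := LinearMap.comp_id _
  mul_smul _ _ _ := rfl
  smul_zero _ := LinearMap.zero_comp _
  smul_add _ _ _ := LinearMap.add_comp _ _ _
  add_smul _ _ _ := LinearMap.comp_add _ _ _
  zero_smul _ := LinearMap.comp_zero _

variable {k n} in
/-- The map `Hom_Λ(E, h) : Hom_Λ(E, X) → Hom_Λ(E, Y)`. -/
def HomE.map {X Y : Type u} [AddCommGroup X] [Module (Lam k n) X] [AddCommGroup Y]
    [Module (Lam k n) Y] (h : X →ₗ[Lam k n] Y) : HomE k n X →ₗ[A k n] HomE k n Y where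
  toFun f := LinearMap.comp h (f : E k n →ₗ[Lam k n] X)
  map_add' _ _ := LinearMap.comp_add _ _ _
  map_smul' _ _ := rfl

/-- The `A_n`-module `P(i) = Hom_Λ(E, [i])`. -/
abbrev P (i : ℕ) : Type u := HomE k n (Ind k n i)

/-- `T = T(1) ⊕ ⋯ ⊕ T(n)`, where `T(i) = P(n)/P(i-1)`, and `P(i-1) → P(n)` is induced by the
inclusion `[i-1] → [n]`; the summand with index `i : Fin n` is `T(i+1)`. -/
abbrev T : Type u :=
  (i : Fin n) → P k n n ⧸ LinearMap.range (HomE.map (can k n (i : ℕ) n))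

/-- The subcategory `F(n)` is given by the torsionless `A_n`-modules of finite length. -/
def torsionlessFin : ObjectProperty (ModuleCat.{u} (A k n)) :=
  fun M ↦ IsFiniteLength (A k n) M ∧ IsTorsionless (A k n) M

/-- `F(n)`, as a full subcategory of the category of modules. -/
abbrev FCat := (torsionlessFin k n).FullSubcategory

/-! ### The torsion submodule `tM` and the functor `δ` -/

/-- The torsion submodule `tM`: the largest submodule of `M` generated by `P(n)`, that is, the sum
of the images of all homomorphisms `P(n) → M`. -/
def tors (M : Type u) [AddCommGroup M] [Module (A k n) M] : Submodule (A k n) M :=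
  ⨆ f : P k n n →ₗ[A k n] M, LinearMap.range f

variable {k n} in
theorem tors_le_comap {M N : Type u} [AddCommGroup M] [Module (A k n) M] [AddCommGroup N]
    [Module (A k n) N] (g : M →ₗ[A k n] N) : tors k n M ≤ (tors k n N).comap g := by
  refine iSup_le fun f ↦ ?_
  rintro _ ⟨p, rfl⟩
  exact (le_iSup (fun f : P k n n →ₗ[A k n] N ↦ LinearMap.range f) (g ∘ₗ f)) ⟨p, rfl⟩

variable [NeZero n]

/-- The two-sided ideal `⟨e(n)⟩` of `A_n`. -/
def idealTop : Ideal (A k n) := (TwoSidedIdeal.span {e k n ⊤}).asIdeal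

instance : (idealTop k n).IsTwoSided :=
  inferInstanceAs (TwoSidedIdeal.asIdeal _).IsTwoSided

variable {k n} in
theorem e_smul_mem_tors {M : Type u} [AddCommGroup M] [Module (A k n) M] (m : M) :
    e k n ⊤ • m ∈ tors k n M := by
  have hn : ((⊤ : Fin n) : ℕ) + 1 = n := by
    have h1 : 0 < n := Nat.pos_of_ne_zero (NeZero.ne n)
    have h2 : (⟨n - 1, by omega⟩ : Fin n) ≤ ⊤ := le_top
    have h3 : n - 1 ≤ ((⊤ : Fin n) : ℕ) := h2
    have h4 := (⊤ : Fin n).2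
    omega
  let c : Ind k n n →ₗ[Lam k n] E k n :=
    LinearMap.single (Lam k n) (fun l : Fin n ↦ Ind k n (l + 1)) ⊤ ∘ₗ can k n n _
  let d : E k n →ₗ[Lam k n] Ind k n n := can k n _ n ∘ₗ LinearMap.proj ⊤
  have hid : ∀ (i j : ℕ) (_ : i = j) (x : Ind k n i), can k n j i (can k n i j x) = x := by
    rintro i _ rfl x
    obtain ⟨y, rfl⟩ := Submodule.Quotient.mk_surjective _ x
    simp [can]
  let f : P k n n →ₗ[A k n] M :=
    { toFun := fun g ↦
        A.of (c ∘ₗ (g : E k n →ₗ[Lam k n] Ind k n n)) • m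
      map_add' := fun g h ↦ by
        rw [← add_smul]
        congr 1
        exact congrArg A.of (LinearMap.comp_add _ _ _)
      map_smul' := fun a g ↦ by
        rw [RingHom.id_apply, smul_smul]
        rfl }
  refine (le_iSup (fun f : P k n n →ₗ[A k n] M ↦ LinearMap.range f) f) ⟨d, ?_⟩
  change A.of (c ∘ₗ d) • m = A.of _ • m
  congr 2
  refine LinearMap.ext fun x ↦ ?_
  simp only [c, d, LinearMap.comp_apply]
  rw [hid _ _ hn]

theorem isTorsionBySet_tors (M : Type u) [AddCommGroup M] [Module (A k n) M] :
    Module.IsTorsionBySet (A k n) (M ⧸ tors k n M) (idealTop k n) := by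
  have key : TwoSidedIdeal.span {e k n ⊤} ≤
      (Module.annihilator (A k n) (M ⧸ tors k n M)).toTwoSided := by
    rw [TwoSidedIdeal.span_le, Set.singleton_subset_iff]
    change e k n ⊤ ∈ (Module.annihilator (A k n) (M ⧸ tors k n M)).toTwoSided
    rw [Ideal.mem_toTwoSided, Module.mem_annihilator]
    intro y
    obtain ⟨m, rfl⟩ := Submodule.Quotient.mk_surjective _ y
    rw [← Submodule.Quotient.mk_smul, Submodule.Quotient.mk_eq_zero]
    exact e_smul_mem_tors m
  rintro y ⟨a, ha⟩
  have h1 : a ∈ (Module.annihilator (A k n) (M ⧸ tors k n M)).toTwoSided := key ha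
  rw [Ideal.mem_toTwoSided, Module.mem_annihilator] at h1
  exact h1 y

/-- The algebra `A_n/⟨e(n)⟩`. -/
def Abar : Type u := A k n ⧸ idealTop k n

instance : Ring (Abar k n) := inferInstanceAs (Ring (A k n ⧸ idealTop k n))

instance : Algebra k (Abar k n) := inferInstanceAs (Algebra k (A k n ⧸ idealTop k n))

/-- The canonical projection `A_n → A_n/⟨e(n)⟩`. -/
def toAbar : A k n →+* Abar k n := Ideal.Quotient.mk (idealTop k n)

/-- `δ M = M/tM`. -/
def Del (M : Type u) [AddCommGroup M] [Module (A k n) M] : Type u := M ⧸ tors k n M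

instance (M : Type u) [AddCommGroup M] [Module (A k n) M] : AddCommGroup (Del k n M) :=
  inferInstanceAs (AddCommGroup (M ⧸ tors k n M))

/-- `M/tM`, which is annihilated by `e(n)`, as a module over `A_n/⟨e(n)⟩`. -/
instance (M : Type u) [AddCommGroup M] [Module (A k n) M] : Module (Abar k n) (Del k n M) :=
  letI : Module (A k n ⧸ idealTop k n) (M ⧸ tors k n M) := (isTorsionBySet_tors k n M).module
  inferInstanceAs (Module (A k n ⧸ idealTop k n) (M ⧸ tors k n M))

/-- The canonical projection `M → M/tM`. -/
def Del.proj (M : Type u) [AddCommGroup M] [Module (A k n) M] : M →+ Del k n M :=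
  (Submodule.mkQ (tors k n M)).toAddMonoidHom

variable {k n} in
theorem Del.proj_surjective (M : Type u) [AddCommGroup M] [Module (A k n) M] :
    Function.Surjective (Del.proj k n M) := Submodule.mkQ_surjective _

variable {k n} in
theorem Del.proj_smul {M : Type u} [AddCommGroup M] [Module (A k n) M] (a : A k n) (m : M) :
    Del.proj k n M (a • m) = toAbar k n a • Del.proj k n M m := rfl

variable {k n} in
/-- The map `M/tM → N/tN` induced by a homomorphism `M → N`. -/
def Del.map {M N : Type u} [AddCommGroup M] [Module (A k n) M] [AddCommGroup N]
    [Module (A k n) N] (g : M →ₗ[A k n] N) : Del k n M →ₗ[Abar k n] Del k n N where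
  toFun := Submodule.mapQ (tors k n M) (tors k n N) g (tors_le_comap g)
  map_add' x y := map_add (Submodule.mapQ (tors k n M) (tors k n N) g (tors_le_comap g)) x y
  map_smul' r y := by
    obtain ⟨a, rfl⟩ := Ideal.Quotient.mk_surjective r
    obtain ⟨m, rfl⟩ := Del.proj_surjective _ y
    exact congrArg (Del.proj k n N) (map_smul g a m)

/-- The functor `δ : M ↦ M/tM` from `A_n`-modules to `A_n/⟨e(n)⟩`-modules. -/
def delta : ModuleCat.{u} (A k n) ⥤ ModuleCat.{u} (Abar k n) where
  obj M := ModuleCat.of (Abar k n) (Del k n M)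
  map g := ModuleCat.ofHom (Del.map g.hom)
  map_id M := by
    ext y
    obtain ⟨m, rfl⟩ := Del.proj_surjective _ y
    rfl
  map_comp f g := by
    ext y
    obtain ⟨m, rfl⟩ := Del.proj_surjective _ y
    rfl

end Auslander

/-! ### The preprojective algebra of type `A_m` -/

section Preprojective

variable (k : Type u) [Field k] (m : ℕ)

/-- Vertices and arrows of the double of the quiver `0 → 1 → ⋯ → m-1` of type `A_m`. -/
inductive PreprojGen : Type
  /-- the path of length zero at the vertex `i` -/
  | vert (i : Fin m)
  /-- the arrow `i → i+1` -/
  | up (i : Fin (m - 1))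
  /-- the opposite arrow `i+1 → i` -/
  | down (i : Fin (m - 1))

/-- The vertex `i`, source of the `i`-th arrow. -/
def src {m : ℕ} (i : Fin (m - 1)) : Fin m := ⟨i, by omega⟩

/-- The vertex `i+1`, target of the `i`-th arrow. -/
def tgt {m : ℕ} (i : Fin (m - 1)) : Fin m := ⟨i + 1, by omega⟩

open PreprojGen FreeAlgebra in
/-- The relations of the preprojective algebra: those of the path algebra of the double quiver
(paths are composed from left to right), and the relation `∑ (α α* - α* α) = 0`. -/
inductive PreprojRel : FreeAlgebra k (PreprojGen m) → FreeAlgebra k (PreprojGen m) → Prop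
  | vert_idem (i : Fin m) : PreprojRel (ι k (vert i) * ι k (vert i)) (ι k (vert i))
  | vert_orth (i j : Fin m) (h : i ≠ j) : PreprojRel (ι k (vert i) * ι k (vert j)) 0
  | sum_vert : PreprojRel (∑ i, ι k (vert i)) 1
  | up_path (i : Fin (m - 1)) :
      PreprojRel (ι k (vert (src i)) * ι k (up i) * ι k (vert (tgt i))) (ι k (up i))
  | down_path (i : Fin (m - 1)) :
      PreprojRel (ι k (vert (tgt i)) * ι k (down i) * ι k (vert (src i))) (ι k (down i))
  | preproj : PreprojRel
      (∑ i : Fin (m - 1), (ι k (up i) * ι k (down i) - ι k (down i) * ι k (up i))) 0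

/-- The preprojective algebra `Π_m` of type `A_m`. -/
def Preproj : Type u := RingQuot (PreprojRel k m)

instance : Ring (Preproj k m) := inferInstanceAs (Ring (RingQuot (PreprojRel k m)))

instance : Algebra k (Preproj k m) := inferInstanceAs (Algebra k (RingQuot (PreprojRel k m)))

/-- The generators of `Π_m`. -/
def Preproj.gen (g : PreprojGen m) : Preproj k m :=
  RingQuot.mkAlgHom k (PreprojRel k m) (FreeAlgebra.ι k g)

/-- `P_Π(i) = Π_m e_i`, the indecomposable projective `Π_m`-module at the vertex `i`. -/
abbrev PPi (i : Fin m) : Ideal (Preproj k m) := Ideal.span {Preproj.gen k m (.vert i)}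

end Preprojective

/-! ### The functor `δ` on `F(n)` with values in the modules over `Π_{n-1}` -/

section DeltaPi

variable {k : Type u} [Field k] {n : ℕ} [NeZero n]

/-- The vertex `i` of the quiver of `Π_{n-1}`, as an index for a summand of `E`. -/
def vtx (i : Fin (n - 1)) : Fin n := Fin.castLE (Nat.sub_le n 1) i

/-- An algebra isomorphism `Π_{n-1} ≅ A_n/⟨e(n)⟩` is the standard one if it sends the vertices to
the classes of the idempotents `e(i)`, the arrows `i → i+1` to the classes of the inclusions
`[i] → [i+1]`, and the arrows `i+1 → i` to the classes of the projections `[i+1] → [i]`.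
There is at most one such isomorphism. -/
def IsStandard (φ : Preproj k (n - 1) ≃ₐ[k] Abar k n) : Prop :=
  (∀ i, φ (Preproj.gen k (n - 1) (.vert i)) = toAbar k n (e k n (vtx i))) ∧
  (∀ i, φ (Preproj.gen k (n - 1) (.up i)) =
    toAbar k n (arrow k n (vtx (src i)) (vtx (tgt i)))) ∧
  (∀ i, φ (Preproj.gen k (n - 1) (.down i)) =
    toAbar k n (arrow k n (vtx (tgt i)) (vtx (src i))))

/-- The functor `δ : F(n) → mod Π_{n-1}`, `M ↦ M/tM`, where `A_n/⟨e(n)⟩`-modules are regarded as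
`Π_{n-1}`-modules through an isomorphism `φ`. -/
def deltaPi (φ : Preproj k (n - 1) ≃ₐ[k] Abar k n) :
    FCat k n ⥤ FinMod (Preproj k (n - 1)) :=
  (finLen (Preproj k (n - 1))).lift
    ((torsionlessFin k n).ι ⋙ delta k n ⋙ ModuleCat.restrictScalars φ.toAlgHom.toRingHom)
    (fun M ↦ by
      refine isFiniteLength_of_semilinear (R := A k n) (M := M.obj)
        ((φ.symm.toAlgHom.toRingHom).comp (toAbar k n))
        (Del.proj k n M.obj) (Del.proj_surjective _) ?_ M.property.1
      intro a m
      change Del.proj k n M.obj (a • m) = φ (φ.symm (toAbar k n a)) • Del.proj k n M.obj m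
      rw [AlgEquiv.apply_symm_apply]
      rfl)

end DeltaPi

end PreprojQuot

end

noncomputable section

namespace PreprojQuot

/-! ### Modules over `k[x]/(x^n)` -/

section Lambda

variable {k : Type u} [Field k] {n : ℕ}

/-! Everything is translated into Λ_n-modules through Hom(E, -). The finite free A_n-modules are the
Hom(E, E^r), and a quotient Hom(E, X)/K is torsionless exactly when K consists of all maps with
values in some submodule Y of X (`exists_eq_homInto`, `isTorsionless_quotient_homInto`). By Smith
normal form (`exists_diagonal_form`) every submodule of E^r is a retract of some E^s. So a finitely
generated torsionless module has projective dimension at most 1 (`projective_homInto`). Since Λ_n is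
self-injective, P(n) is injective (`exists_extension_P`).

These facts give the equivalence. Full: the obstruction to lifting M → N/tN to M → N lies in Ext¹(M,
tN). It vanishes because tN is a quotient of the injective module P(n)^s and M has projective
dimension at most 1 (`exists_lift_of_isTorsionless`). Faithful: a map dies under δ iff its image
lies in tN. As a torsionless quotient of Hom(E, [n]^s), tN is Hom(E, [n]^s)/Hom(E, Y); diagonalizing
Y makes it a sum of modules P(n)/P(d), hence a retract of a power of T
(`exists_factorization_of_range_le`). Conversely T is generated by P(n). Dense: if U is the cokernel
of the map Hom(E, E^s) → Hom(E, E^r) given by g₀, adding an embedding of E^s into a power of [n] as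
a second component makes g₀ injective. The new cokernel is torsionless, and the added part is
precisely its torsion (`exists_torsionless_cover`).

For the algebra isomorphism, the 2-cycles of Π_{n-1} add up to an element z commuting with all
generators, and every element of e_i Π e_j is a polynomial in z times the shortest path
(`exists_pv_mul_mul_pv`). In A_n/⟨e(n)⟩ the element z becomes multiplication by x, which gives
surjectivity. An element of ⟨e(n)⟩ sends anything killed by x^t to a multiple of x^(n-t); this
forces a power of X to divide the polynomial, and that same power of z already kills the shortest
path in Π_{n-1} (`pz_pow_mul_pp`), which gives injectivity. Finally P(j) is A_n e(j), and its
torsion is its intersection with ⟨e(n)⟩ (`PToA_mem_idealTop_iff`). -/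

theorem xbar_pow_eq_zero {i : ℕ} (h : n ≤ i) : xbar k n ^ i = 0 := by
  have h0 : xbar k n ^ n = 0 := by
    change Ideal.Quotient.mk (Ideal.span {(Polynomial.X : Polynomial k) ^ n}) Polynomial.X ^ n = 0
    rw [← map_pow, Ideal.Quotient.eq_zero_iff_mem]
    exact Ideal.mem_span_singleton_self _
  rw [← Nat.sub_add_cancel h, pow_add, h0, mul_zero]

variable (k n) in
/-- The canonical projection `k[X] → Λ_n`. -/
def toLam : Polynomial k →+* Lam k n :=
  Ideal.Quotient.mk (Ideal.span {(Polynomial.X : Polynomial k) ^ n})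

theorem toLam_surjective : Function.Surjective (toLam k n) := Ideal.Quotient.mk_surjective

@[simp] theorem toLam_X : toLam k n Polynomial.X = xbar k n := rfl

theorem xbar_pow_smul {X : Type*} [AddCommGroup X] [Module (Lam k n) X] (i : ℕ) (z : X) :
    xbar k n ^ i • z = toLam k n (Polynomial.X ^ i) • z := by
  rw [map_pow, toLam_X]

theorem xbar_pow_smul_eq_zero {X : Type*} [AddCommGroup X] [Module (Lam k n) X] {i : ℕ}
    (h : n ≤ i) (z : X) : xbar k n ^ i • z = 0 := by
  rw [xbar_pow_eq_zero h, zero_smul]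

theorem toLam_C (c : k) : toLam k n (Polynomial.C c) = algebraMap k (Lam k n) c := rfl

theorem toLam_eq_zero_iff (q : Polynomial k) :
    toLam k n q = 0 ↔ (Polynomial.X : Polynomial k) ^ n ∣ q := by
  rw [← Ideal.mem_span_singleton]
  exact Ideal.Quotient.eq_zero_iff_mem

theorem Ind.exists_smul {i : ℕ} (z : Ind k n i) :
    ∃ q : Polynomial k, z = toLam k n q • (1 : Ind k n i) := by
  obtain ⟨a, rfl⟩ := Ideal.Quotient.mk_surjective z
  obtain ⟨q, rfl⟩ := toLam_surjective a
  exact ⟨q, by rw [Algebra.smul_def, mul_one]; rfl⟩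

/-- Questions in [i] become divisibility questions in the domain k[X], where powers of X can be
cancelled. A lift from Λ_n is only determined modulo X^n, which is harmless because i ≤ n. -/
theorem Ind.smul_one_eq_zero_iff {i : ℕ} (hi : i ≤ n) (q : Polynomial k) :
    toLam k n q • (1 : Ind k n i) = 0 ↔ (Polynomial.X : Polynomial k) ^ i ∣ q := by
  rw [Algebra.smul_def, mul_one]
  change Ideal.Quotient.mk _ (toLam k n q) = 0 ↔ _
  rw [Ideal.Quotient.eq_zero_iff_mem, Ideal.mem_span_singleton]
  constructor
  · rintro ⟨a, ha⟩
    obtain ⟨p, rfl⟩ := toLam_surjective a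
    rw [← toLam_X, ← map_pow, ← map_mul, ← sub_eq_zero, ← map_sub, toLam_eq_zero_iff] at ha
    have h2 : (Polynomial.X : Polynomial k) ^ i ∣ q - Polynomial.X ^ i * p :=
      (pow_dvd_pow _ hi).trans ha
    exact (dvd_sub_left (dvd_mul_right _ _)).1 h2
  · rintro ⟨p, rfl⟩
    exact ⟨toLam k n p, by rw [map_mul, map_pow, toLam_X]⟩

theorem Ind.pow_smul {i j : ℕ} (h : i ≤ j) (z : Ind k n i) : xbar k n ^ j • z = 0 := by
  obtain ⟨a, rfl⟩ := Ideal.Quotient.mk_surjective z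
  change Ideal.Quotient.mk _ (xbar k n ^ j * a) = 0
  rw [Ideal.Quotient.eq_zero_iff_mem, Ideal.mem_span_singleton]
  exact (pow_dvd_pow _ h).mul_right _

/-- Cancel X^i in X^j ∣ X^i q. The truncated exponent makes the case j ≤ i trivially true. -/
theorem Ind.exists_eq_pow_smul {i j : ℕ} (hj : j ≤ n) (z : Ind k n j)
    (hz : xbar k n ^ i • z = 0) : ∃ w, z = xbar k n ^ (j - i) • w := by
  obtain ⟨q, rfl⟩ := Ind.exists_smul z
  rcases le_total j i with h | h
  · exact ⟨toLam k n q • 1, by rw [Nat.sub_eq_zero_of_le h, pow_zero, one_smul]⟩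
  rw [xbar_pow_smul, smul_smul, ← map_mul, Ind.smul_one_eq_zero_iff hj] at hz
  have h1 : (Polynomial.X : Polynomial k) ^ (j - i) ∣ q := by
    have : (Polynomial.X : Polynomial k) ^ j = Polynomial.X ^ i * Polynomial.X ^ (j - i) := by
      rw [← pow_add]; congr 1; omega
    rw [this] at hz
    exact (mul_dvd_mul_iff_left (pow_ne_zero _ Polynomial.X_ne_zero)).1 hz
  obtain ⟨p, rfl⟩ := h1
  exact ⟨toLam k n p • 1, by rw [map_mul, map_pow, toLam_X, mul_smul]⟩

section lift

variable {X : Type*} [AddCommGroup X] [Module (Lam k n) X]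

/-- The homomorphism `[i] → X` sending the generator to an element killed by `x^i`. -/
def Ind.lift {i : ℕ} (z : X) (hz : xbar k n ^ i • z = 0) : Ind k n i →ₗ[Lam k n] X :=
  Submodule.liftQ _ (LinearMap.toSpanSingleton (Lam k n) X z) (by
    rw [Ideal.span_le, Set.singleton_subset_iff]
    simpa using hz)

@[simp] theorem Ind.lift_one {i : ℕ} (z : X) (hz : xbar k n ^ i • z = 0) :
    Ind.lift z hz (1 : Ind k n i) = z := by
  change Submodule.liftQ _ (LinearMap.toSpanSingleton (Lam k n) X z) _
    (Submodule.Quotient.mk 1) = z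
  rw [Submodule.liftQ_apply, LinearMap.toSpanSingleton_apply, one_smul]

theorem Ind.hom_ext {i : ℕ} {f g : Ind k n i →ₗ[Lam k n] X} (h : f 1 = g 1) : f = g := by
  refine LinearMap.ext fun z ↦ ?_
  obtain ⟨q, rfl⟩ := Ind.exists_smul z
  rw [map_smul, map_smul, h]

end lift

theorem can_one (i j : ℕ) : can k n i j 1 = xbar k n ^ (j - i) • (1 : Ind k n j) := by
  change Submodule.mapQ _ _ (LinearMap.mulLeft (Lam k n) (xbar k n ^ (j - i))) _
    (Submodule.Quotient.mk 1) = _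
  rw [Submodule.mapQ_apply]
  rfl

theorem can_injective {i j : ℕ} (h : i ≤ j) (hj : j ≤ n) :
    Function.Injective (can k n i j) := by
  rw [← LinearMap.ker_eq_bot, LinearMap.ker_eq_bot']
  intro z hz
  obtain ⟨q, rfl⟩ := Ind.exists_smul z
  rw [map_smul, can_one, xbar_pow_smul, smul_smul, ← map_mul,
    Ind.smul_one_eq_zero_iff hj] at hz
  rw [Ind.smul_one_eq_zero_iff (h.trans hj)]
  have : (Polynomial.X : Polynomial k) ^ j = Polynomial.X ^ i * Polynomial.X ^ (j - i) := by
    rw [← pow_add]; congr 1; omega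
  rw [this] at hz
  exact (mul_dvd_mul_iff_right (pow_ne_zero _ Polynomial.X_ne_zero)).1 hz

theorem mem_range_can {i j : ℕ} (z : Ind k n j) :
    (∃ w, can k n i j w = z) ↔ ∃ w, z = xbar k n ^ (j - i) • w := by
  constructor
  · rintro ⟨w, rfl⟩
    obtain ⟨q, rfl⟩ := Ind.exists_smul w
    exact ⟨toLam k n q • 1, by rw [map_smul, can_one, smul_comm]⟩
  · rintro ⟨w, rfl⟩
    obtain ⟨q, rfl⟩ := Ind.exists_smul w
    exact ⟨toLam k n q • 1, by rw [map_smul, can_one, smul_comm]⟩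

/-! #### The Frobenius form -/

variable (k n) in
/-- The linear form on `[n]` which reads off the coefficient of `x^(n-1)`. -/
theorem exists_topCoeff [NeZero n] : ∃ τ : Ind k n n →+ k,
    (∀ (c : k) (z : Ind k n n), τ (algebraMap k (Lam k n) c • z) = c * τ z) ∧
    ∀ i, τ (xbar k n ^ i • 1) = if i + 1 = n then 1 else 0 := by
  have hn : 0 < n := Nat.pos_of_ne_zero (NeZero.ne n)
  let π : Polynomial k →+ Ind k n n :=
    (Ideal.Quotient.mk (Ideal.span {xbar k n ^ n})).toAddMonoidHom.comp
      (toLam k n).toAddMonoidHom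
  have hπ : ∀ q, π q = toLam k n q • (1 : Ind k n n) := fun q ↦ by
    rw [Algebra.smul_def, mul_one]; rfl
  have hs : Function.Surjective π := Ideal.Quotient.mk_surjective.comp toLam_surjective
  -- The coefficient of X^(n-1) vanishes on multiples of X^n, so it descends to [n].
  have hk : π.ker ≤ (Polynomial.lcoeff k (n - 1)).toAddMonoidHom.ker := by
    intro q hq
    rw [AddMonoidHom.mem_ker, hπ, Ind.smul_one_eq_zero_iff le_rfl, Polynomial.X_pow_dvd_iff] at hq
    exact hq (n - 1) (by omega)
  let τ := π.liftOfSurjective hs ⟨(Polynomial.lcoeff k (n - 1)).toAddMonoidHom, hk⟩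
  have hτ : ∀ q, τ (toLam k n q • 1) = q.coeff (n - 1) := fun q ↦ by
    rw [← hπ]
    exact π.liftOfRightInverse_comp_apply _ _ ⟨(Polynomial.lcoeff k (n - 1)).toAddMonoidHom, hk⟩ q
  refine ⟨τ, fun c z ↦ ?_, fun i ↦ ?_⟩
  · obtain ⟨q, rfl⟩ := Ind.exists_smul z
    rw [smul_smul, ← toLam_C, ← map_mul, hτ, hτ, Polynomial.coeff_C_mul]
  · rw [xbar_pow_smul, hτ, Polynomial.coeff_X_pow]
    congr 1
    apply propext
    omega

section frob

variable {X : Type*} [AddCommGroup X] [Module (Lam k n) X]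

/-- The homomorphism `X → [n]` corresponding to a linear form on `X`. -/
def frob (ψ : X →+ k)
    (hψ : ∀ (c : k) (z : X), ψ (algebraMap k (Lam k n) c • z) = c * ψ z) :
    X →ₗ[Lam k n] Ind k n n where
  -- If f : X → [n] has top coefficient ψ, then the coefficient of x^(n-1-i) in f(z) is the top
  -- coefficient of x^i f(z) = f(x^i z), that is ψ(x^i z). This forces the formula.
  toFun z := ∑ i ∈ Finset.range n,
    (algebraMap k (Lam k n) (ψ (xbar k n ^ i • z)) * xbar k n ^ (n - 1 - i)) • 1
  map_add' y z := by
    simp only [smul_add, map_add, add_mul, add_smul, Finset.sum_add_distrib]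
  map_smul' a z := by
    obtain ⟨q, rfl⟩ := toLam_surjective a
    simp only [RingHom.id_apply]
    induction q using Polynomial.induction_on' generalizing z with
    | add p q hp hq =>
      rw [map_add]
      simp only [add_smul, smul_add, map_add, add_mul, Finset.sum_add_distrib]
      rw [hp, hq]
    | monomial m c =>
      have hx : ∀ z : X, ∑ i ∈ Finset.range n,
          (algebraMap k (Lam k n) (ψ (xbar k n ^ i • xbar k n • z)) * xbar k n ^ (n - 1 - i)) •
            (1 : Ind k n n) = xbar k n • ∑ i ∈ Finset.range n,
          (algebraMap k (Lam k n) (ψ (xbar k n ^ i • z)) * xbar k n ^ (n - 1 - i)) • 1 := by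
        intro z
        rcases n with _ | n
        · simp
        -- The two sums agree after an index shift. The leftover terms, the last on the left and the
        -- first on the right, both contain the full nilpotent power of x.
        rw [Finset.smul_sum, Finset.sum_range_succ, Finset.sum_range_succ']
        congr 1
        · refine Finset.sum_congr rfl fun i hi ↦ ?_
          rw [smul_smul, smul_smul, ← pow_succ, mul_left_comm, ← pow_succ']
          congr 3
          have := Finset.mem_range.1 hi
          omega
        · rw [smul_smul, ← pow_succ, xbar_pow_smul_eq_zero le_rfl, map_zero, map_zero,
            zero_mul, zero_smul, smul_smul, mul_left_comm, ← pow_succ', mul_smul,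
            xbar_pow_smul_eq_zero (X := Ind k (n + 1) (n + 1)) (i := n + 1 - 1 - 0 + 1) (by omega),
            smul_zero]
      have hxm : ∀ (m : ℕ) (z : X), ∑ i ∈ Finset.range n,
          (algebraMap k (Lam k n) (ψ (xbar k n ^ i • xbar k n ^ m • z)) *
            xbar k n ^ (n - 1 - i)) •
            (1 : Ind k n n) = xbar k n ^ m • ∑ i ∈ Finset.range n,
          (algebraMap k (Lam k n) (ψ (xbar k n ^ i • z)) * xbar k n ^ (n - 1 - i)) • 1 := by
        intro m
        induction m with
        | zero => intro z; simp
        | succ m ih =>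
          intro z
          rw [pow_succ, mul_smul, ih, hx, smul_smul]
      have hm : toLam k n (Polynomial.monomial m c) =
          algebraMap k (Lam k n) c * xbar k n ^ m := by
        rw [← Polynomial.C_mul_X_pow_eq_monomial, map_mul, map_pow, toLam_X, toLam_C]
      rw [hm, mul_smul, mul_smul, ← hxm, Finset.smul_sum]
      refine Finset.sum_congr rfl fun i _ ↦ ?_
      rw [smul_comm, hψ, map_mul, mul_assoc, mul_smul]

theorem frob_apply (ψ : X →+ k)
    (hψ : ∀ (c : k) (z : X), ψ (algebraMap k (Lam k n) c • z) = c * ψ z) (z : X) :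
    frob ψ hψ z = ∑ i ∈ Finset.range n,
      (algebraMap k (Lam k n) (ψ (xbar k n ^ i • z)) * xbar k n ^ (n - 1 - i)) • 1 := rfl

/-- Only the summand i = 0 reaches x^(n-1). A linear form on X is thus the top coefficient of a
Λ_n-homomorphism X → [n]; this is the self-injectivity of Λ_n in the form used below. -/
theorem topCoeff_frob [NeZero n] {τ : Ind k n n →+ k}
    (hτ : ∀ (c : k) (z : Ind k n n), τ (algebraMap k (Lam k n) c • z) = c * τ z)
    (hτx : ∀ i, τ (xbar k n ^ i • 1) = if i + 1 = n then 1 else 0) (ψ : X →+ k)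
    (hψ : ∀ (c : k) (z : X), ψ (algebraMap k (Lam k n) c • z) = c * ψ z) (z : X) :
    τ (frob ψ hψ z) = ψ z := by
  have hn : 0 < n := Nat.pos_of_ne_zero (NeZero.ne n)
  rw [frob_apply, map_sum, Finset.sum_eq_single 0]
  · rw [mul_smul, hτ, hτx, if_pos (by omega), mul_one, pow_zero, one_smul]
  · intro i hi h0
    have := Finset.mem_range.1 hi
    rw [mul_smul, hτ, hτx, if_neg (by omega), mul_zero]
  · intro h
    exact absurd (Finset.mem_range.2 hn) h

theorem frob_topCoeff [NeZero n] {τ : Ind k n n →+ k}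
    (hτ : ∀ (c : k) (z : Ind k n n), τ (algebraMap k (Lam k n) c • z) = c * τ z)
    (hτx : ∀ i, τ (xbar k n ^ i • 1) = if i + 1 = n then 1 else 0) :
    frob τ hτ = LinearMap.id := by
  have hn : 0 < n := Nat.pos_of_ne_zero (NeZero.ne n)
  refine Ind.hom_ext ?_
  rw [frob_apply, Finset.sum_eq_single (n - 1)]
  · rw [hτx, if_pos (by omega)]; simp
  · intro i hi h0
    have := Finset.mem_range.1 hi
    rw [hτx, if_neg (by omega), map_zero, zero_mul, zero_smul]
  · intro h
    exact absurd (Finset.mem_range.2 (by omega)) h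

end frob

/-! #### Submodules of free modules -/

/-- Pull Y back to k[X]^s and take the Smith normal form over the principal ideal domain k[X]. The
preimage contains X^n k[X]^s, so each invariant divides X^n and is a power of X up to a unit.
Reducing the change of basis modulo x^n gives θ. -/
theorem exists_diagonal_form {s : ℕ}
    (Y : Submodule (Lam k n) (Fin s → Ind k n n)) :
    ∃ (θ : (Fin s → Ind k n n) ≃ₗ[Lam k n] (Fin s → Ind k n n)) (c : Fin s → ℕ),
      (∀ i, c i ≤ n) ∧ ∀ v, v ∈ Y ↔ ∀ i, ∃ w, θ v i = xbar k n ^ c i • w := by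
  let ρ : Polynomial k →+* Ind k n n := (Ideal.Quotient.mk (Ideal.span {xbar k n ^ n})).comp
    (toLam k n)
  have hρ : ∀ q, ρ q = toLam k n q • (1 : Ind k n n) := fun q ↦ by
    rw [Algebra.smul_def, mul_one]; rfl
  have hρs : Function.Surjective ρ := Ideal.Quotient.mk_surjective.comp toLam_surjective
  have hρ0 : ∀ q, ρ q = 0 ↔ (Polynomial.X : Polynomial k) ^ n ∣ q := fun q ↦ by
    rw [hρ, Ind.smul_one_eq_zero_iff le_rfl]
  let N : Submodule (Polynomial k) (Fin s → Polynomial k) :=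
    { carrier := {v | ρ ∘ v ∈ Y}
      add_mem' := fun {a b} ha hb ↦ by
        have : ρ ∘ (a + b) = ρ ∘ a + ρ ∘ b := by ext i; simp
        change ρ ∘ (a + b) ∈ Y
        rw [this]; exact Y.add_mem ha hb
      zero_mem' := by
        have : ρ ∘ (0 : Fin s → Polynomial k) = 0 := by ext i; simp
        change ρ ∘ (0 : Fin s → Polynomial k) ∈ Y
        rw [this]; exact Y.zero_mem
      smul_mem' := fun q v hv ↦ by
        have : ρ ∘ (q • v) = toLam k n q • (ρ ∘ v) := by
          ext i
          simp only [Function.comp, Pi.smul_apply, smul_eq_mul, map_mul]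
          rw [hρ q, smul_mul_assoc, one_mul]
        change ρ ∘ (q • v) ∈ Y
        rw [this]; exact Y.smul_mem _ hv }
  have hN : ∀ v, v ∈ N ↔ ρ ∘ v ∈ Y := fun v ↦ Iff.rfl
  obtain ⟨m, snf⟩ := Submodule.smithNormalForm (Pi.basisFun (Polynomial k) (Fin s)) N
  -- Basis vectors outside the range of the embedding get the invariant 0; that these do not occur
  -- follows afterwards from d j ∣ X^n.
  have hd : ∃ d : Fin s → Polynomial k, ∀ v, v ∈ N ↔ ∀ j, d j ∣ snf.bM.repr v j := by
    classical
    refine ⟨fun j ↦ if h : j ∈ Set.range snf.f then snf.a h.choose else 0, fun v ↦ ?_⟩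
    constructor
    · intro hv j
      by_cases h : j ∈ Set.range snf.f
      · simp only [dif_pos h]
        have := snf.repr_apply_embedding_eq_repr_smul (m := ⟨v, hv⟩) (i := h.choose)
        rw [h.choose_spec] at this
        simp only at this
        rw [this, map_smul]
        exact dvd_mul_right _ _
      · simp only [dif_neg h]
        have := snf.repr_eq_zero_of_notMem_range ⟨v, hv⟩ h
        simp only at this
        rw [this]
    · intro h
      rw [← snf.bM.sum_repr v]
      refine N.sum_mem fun j _ ↦ ?_
      by_cases hj : j ∈ Set.range snf.f
      · have h2 := h j
        simp only [dif_pos hj] at h2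
        obtain ⟨q, hq⟩ := h2
        rw [hq, mul_comm, mul_smul]
        refine N.smul_mem _ ?_
        have := snf.snf hj.choose
        rw [hj.choose_spec] at this
        rw [← this]
        exact (snf.bN _).2
      · have h2 := h j
        simp only [dif_neg hj, zero_dvd_iff] at h2
        rw [h2, zero_smul]
        exact N.zero_mem
  obtain ⟨d, hd⟩ := hd
  have hdX : ∀ j, d j ∣ (Polynomial.X : Polynomial k) ^ n := by
    intro j
    have : (Polynomial.X : Polynomial k) ^ n • snf.bM j ∈ N := by
      rw [hN]
      have : ρ ∘ ((Polynomial.X : Polynomial k) ^ n • snf.bM j) = 0 := by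
        ext i
        simp only [Function.comp, Pi.smul_apply, smul_eq_mul, Pi.zero_apply]
        rw [hρ0]
        exact dvd_mul_right _ _
      rw [this]; exact Y.zero_mem
    have := (hd _).1 this j
    simpa using this
  have hc : ∀ j, ∃ c ≤ n, Associated (d j) (Polynomial.X ^ c) := fun j ↦
    (dvd_prime_pow Polynomial.prime_X n).1 (hdX j)
  choose c hcn hc using hc
  let F := snf.bM.equivFun
  -- Reduction of a matrix entry by entry. It is compatible with the projection ρ, so inverse
  -- matrices stay inverse.
  let mat : ((Fin s → Polynomial k) →ₗ[Polynomial k] (Fin s → Polynomial k)) →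
      ((Fin s → Ind k n n) →ₗ[Lam k n] (Fin s → Ind k n n)) := fun f ↦
    (Matrix.toLin' ((LinearMap.toMatrix' f).map ρ)).restrictScalars (Lam k n)
  have hmatc : ∀ f v, mat f (ρ ∘ v) = ρ ∘ (f v) := by
    intro f v
    change Matrix.toLin' ((LinearMap.toMatrix' f).map ρ) (ρ ∘ v) = _
    rw [Matrix.toLin'_apply]
    ext i
    have := congrFun (LinearMap.toMatrix'_mulVec f v) i
    rw [Function.comp_apply, ← this, RingHom.map_mulVec]
  have hsurj : ∀ w : Fin s → Ind k n n, ∃ v : Fin s → Polynomial k, ρ ∘ v = w := fun w ↦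
    ⟨fun i ↦ (hρs (w i)).choose, funext fun i ↦ (hρs (w i)).choose_spec⟩
  have h1 : mat F.toLinearMap ∘ₗ mat F.symm.toLinearMap = LinearMap.id := by
    refine LinearMap.ext fun w ↦ ?_
    obtain ⟨v, rfl⟩ := hsurj w
    rw [LinearMap.comp_apply, hmatc, hmatc]
    simp
  have h2 : mat F.symm.toLinearMap ∘ₗ mat F.toLinearMap = LinearMap.id := by
    refine LinearMap.ext fun w ↦ ?_
    obtain ⟨v, rfl⟩ := hsurj w
    rw [LinearMap.comp_apply, hmatc, hmatc]
    simp
  let θ : (Fin s → Ind k n n) ≃ₗ[Lam k n] (Fin s → Ind k n n) :=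
    LinearEquiv.ofLinearMap (mat F.toLinearMap) (mat F.symm.toLinearMap) h1 h2
  refine ⟨θ, c, hcn, ?_⟩
  · intro w
    obtain ⟨v, rfl⟩ := hsurj w
    rw [← hN, hd]
    refine forall_congr' fun j ↦ ?_
    have : θ (ρ ∘ v) j = ρ (snf.bM.repr v j) := by
      change mat F.toLinearMap (ρ ∘ v) j = _
      rw [hmatc]
      rfl
    rw [this, (hc j).dvd_iff_dvd_left]
    constructor
    · rintro ⟨q, hq⟩
      exact ⟨ρ q, by rw [hq, map_mul, hρ, hρ q, map_pow, toLam_X, smul_mul_assoc, one_mul]⟩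
    · rintro ⟨w, hw⟩
      obtain ⟨q, rfl⟩ := hρs w
      have h2 : ρ (snf.bM.repr v j - Polynomial.X ^ c j * q) = 0 := by
        rw [map_sub, map_mul, hw, hρ (_ ^ _), map_pow, toLam_X, smul_mul_assoc, one_mul, sub_self]
      rw [hρ0] at h2
      exact (dvd_sub_left (dvd_mul_right _ _)).1 ((pow_dvd_pow _ (hcn j)).trans h2)

end Lambda

/-! ### Modules over the Auslander algebra -/

section HomModules

variable {k : Type u} [Field k] {n : ℕ}
variable {X Y : Type u} [AddCommGroup X] [Module (Lam k n) X] [AddCommGroup Y]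
  [Module (Lam k n) Y]

/-- An element of `HomE k n X`, as a linear map. -/
def HomE.ap (h : HomE k n X) : E k n →ₗ[Lam k n] X := h

theorem HomE.ext {g h : HomE k n X} (H : ∀ y, g.ap y = h.ap y) : g = h :=
  LinearMap.ext H

@[simp] theorem HomE.ap_zero (y : E k n) : (0 : HomE k n X).ap y = 0 := rfl

@[simp] theorem HomE.ap_add (g h : HomE k n X) (y : E k n) :
    (g + h).ap y = g.ap y + h.ap y := rfl

@[simp] theorem HomE.ap_smul (a : A k n) (h : HomE k n X) (y : E k n) :
    (a • h).ap y = h.ap (a.toEnd y) := rfl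

@[simp] theorem HomE.ap_map (f : X →ₗ[Lam k n] Y) (h : HomE k n X) (y : E k n) :
    (HomE.map f h).ap y = f (h.ap y) := rfl

@[simp] theorem A.toEnd_of (f : E k n →ₗ[Lam k n] E k n) : (A.of f).toEnd = f := rfl

theorem A.toEnd_mul (a b : A k n) : (a * b).toEnd = b.toEnd ∘ₗ a.toEnd := rfl

theorem A.toEnd_add (a b : A k n) : (a + b).toEnd = a.toEnd + b.toEnd := rfl

theorem A.toEnd_injective : Function.Injective (A.toEnd (k := k) (n := n)) :=
  MulOpposite.unop_injective

theorem A.toEnd_algebraMap (c : k) (y : E k n) :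
    (algebraMap k (A k n) c).toEnd y = algebraMap k (Lam k n) c • y := by
  change (algebraMap k (Module.End (Lam k n) (E k n)) c) y = _
  rw [Module.algebraMap_end_apply, algebraMap_smul]

variable (k n) in
/-- The regular module is `Hom(E, E)`. -/
def homESelf : HomE k n (E k n) ≃ₗ[A k n] A k n where
  toFun h := A.of h.ap
  invFun a := a.toEnd
  map_add' _ _ := rfl
  map_smul' _ _ := rfl
  left_inv _ := rfl
  right_inv _ := rfl

variable (k n) in
/-- `Hom(E, E^r)` is a free module of rank `r`. -/
def homEFree (r : ℕ) : HomE k n (Fin r → E k n) ≃ₗ[A k n] (Fin r → A k n) where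
  toFun h i := A.of (LinearMap.proj i ∘ₗ h.ap)
  invFun a := LinearMap.pi fun i ↦ (a i).toEnd
  map_add' _ _ := rfl
  map_smul' _ _ := rfl
  left_inv _ := rfl
  right_inv _ := rfl

theorem homEFree_apply_toEnd (r : ℕ) (h : HomE k n (Fin r → E k n)) (i : Fin r) (y : E k n) :
    (homEFree k n r h i).toEnd y = h.ap y i := rfl

/-- The homomorphisms with values in a given submodule. -/
def homInto (Y : Submodule (Lam k n) X) : Submodule (A k n) (HomE k n X) where
  carrier := {h | ∀ y, h.ap y ∈ Y}
  add_mem' hg hh y := Y.add_mem (hg y) (hh y)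
  zero_mem' _ := Y.zero_mem
  smul_mem' _ _ hh _ := hh _

theorem mem_homInto {Y : Submodule (Lam k n) X} {h : HomE k n X} :
    h ∈ homInto Y ↔ ∀ y, h.ap y ∈ Y := Iff.rfl

/-- Left exactness of Hom(E, -): a map with values in the image of f can be pulled back along f. -/
theorem range_map {f : X →ₗ[Lam k n] Y} (hf : Function.Injective f) :
    LinearMap.range (HomE.map f) = homInto (LinearMap.range f) := by
  ext h
  constructor
  · rintro ⟨g, rfl⟩ y
    exact ⟨g.ap y, rfl⟩
  · intro H
    let h' : E k n →ₗ[Lam k n] LinearMap.range f := h.ap.codRestrict _ H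
    refine ⟨((LinearEquiv.ofInjective f hf).symm.toLinearMap ∘ₗ h' : E k n →ₗ[Lam k n] X), ?_⟩
    refine HomE.ext fun y ↦ ?_
    change f ((LinearEquiv.ofInjective f hf).symm (h' y)) = h.ap y
    have := LinearEquiv.apply_symm_apply (LinearEquiv.ofInjective f hf) (h' y)
    exact congrArg Subtype.val this

/-! #### Finite length -/

instance : Module.Finite k (Lam k n) :=
  (Polynomial.monic_X_pow n).finite_quotient

instance (i : ℕ) : Module.Finite k (Ind k n i) :=
  Module.Finite.of_surjective (Ideal.Quotient.mkₐ k (Ideal.span {xbar k n ^ i})).toLinearMap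
    Ideal.Quotient.mk_surjective

instance : Module.Finite k (Module.End (Lam k n) (E k n)) :=
  Module.Finite.of_injective (LinearMap.restrictScalarsₗ k (Lam k n) (E k n) (E k n) k)
    (LinearMap.restrictScalars_injective k)

instance : Module.Finite k (A k n) :=
  Module.Finite.equiv (MulOpposite.opLinearEquiv k (M := Module.End (Lam k n) (E k n)))

instance : IsNoetherianRing (A k n) := isNoetherian_of_tower k inferInstance

instance : IsArtinianRing (A k n) := isArtinian_of_tower k inferInstance

theorem finLen_of_finite {M : Type*} [AddCommGroup M] [Module (A k n) M]
    [Module.Finite (A k n) M] : IsFiniteLength (A k n) M :=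
  isFiniteLength_iff_isNoetherian_isArtinian.2 ⟨inferInstance, inferInstance⟩

instance (r : ℕ) : Module.Finite (A k n) (HomE k n (Fin r → E k n)) :=
  Module.Finite.equiv (homEFree k n r).symm

theorem exists_retract_ind {d : ℕ} (hd : d ≤ n) :
    ∃ (i : Ind k n d →ₗ[Lam k n] E k n) (p : E k n →ₗ[Lam k n] Ind k n d),
      p ∘ₗ i = LinearMap.id := by
  rcases d with _ | d
  · refine ⟨0, 0, LinearMap.ext fun z ↦ ?_⟩
    have : z = 0 := (one_smul (Lam k n) z).symm.trans
      ((congrArg (· • z) (pow_zero (xbar k n)).symm).trans (Ind.pow_smul (le_refl 0) z))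
    simp [this]
  · refine ⟨LinearMap.single (Lam k n) (fun l : Fin n ↦ Ind k n (l + 1)) ⟨d, hd⟩,
      LinearMap.proj (⟨d, hd⟩ : Fin n), LinearMap.ext fun z ↦ ?_⟩
    simp

instance (X : Type u) [AddCommGroup X] [Module (Lam k n) X] (r : ℕ)
    [Module.Finite (A k n) (HomE k n X)] : Module.Finite (A k n) (HomE k n (Fin r → X)) := by
  let f : (Fin r → HomE k n X) →ₗ[A k n] HomE k n (Fin r → X) :=
    { toFun := fun h ↦ LinearMap.pi fun i ↦ (h i).ap
      map_add' := fun _ _ ↦ rfl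
      map_smul' := fun _ _ ↦ rfl }
  exact Module.Finite.of_surjective f fun h ↦ ⟨fun i ↦ HomE.map (LinearMap.proj i) h, rfl⟩

theorem finite_P {d : ℕ} (hd : d ≤ n) : Module.Finite (A k n) (P k n d) := by
  obtain ⟨i, p, hip⟩ := exists_retract_ind (k := k) hd
  refine Module.Finite.of_surjective (HomE.map p ∘ₗ (homESelf k n).symm.toLinearMap) fun h ↦ ?_
  refine ⟨homESelf k n (HomE.map i h), HomE.ext fun y ↦ ?_⟩
  exact LinearMap.congr_fun hip (h.ap y)

instance : Module.Finite (A k n) (P k n n) := finite_P le_rfl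

instance : Module.Finite (A k n) (T k n) := inferInstance

/-! #### The idempotent `e(n)` -/

theorem can_can_of_eq {i j : ℕ} (h : i = j) (x : Ind k n i) : can k n j i (can k n i j x) = x := by
  subst h
  obtain ⟨q, rfl⟩ := Ind.exists_smul x
  simp [can_one]

section top

variable [NeZero n]

theorem top_add_one : ((⊤ : Fin n) : ℕ) + 1 = n := by
  have h1 : 0 < n := Nat.pos_of_ne_zero (NeZero.ne n)
  have h2 : (⟨n - 1, by omega⟩ : Fin n) ≤ ⊤ := le_top
  have h3 : n - 1 ≤ ((⊤ : Fin n) : ℕ) := h2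
  have h4 := (⊤ : Fin n).2
  omega

variable (k n) in
/-- The inclusion `[n] → E`. -/
def topIn : Ind k n n →ₗ[Lam k n] E k n :=
  LinearMap.single (Lam k n) (fun l : Fin n ↦ Ind k n (l + 1)) ⊤ ∘ₗ can k n n _

variable (k n) in
/-- The projection `E → [n]`. -/
def topPr : E k n →ₗ[Lam k n] Ind k n n := can k n _ n ∘ₗ LinearMap.proj ⊤

theorem topPr_topIn (x : Ind k n n) : topPr k n (topIn k n x) = x := by
  simp only [topPr, topIn, LinearMap.comp_apply, LinearMap.coe_proj, Function.eval,
    LinearMap.coe_single, Pi.single_eq_same]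
  exact can_can_of_eq top_add_one.symm x

theorem toEnd_e_top : (e k n ⊤).toEnd = topIn k n ∘ₗ topPr k n := by
  refine LinearMap.ext fun x ↦ ?_
  simp only [topIn, topPr, LinearMap.comp_apply]
  rw [can_can_of_eq top_add_one]
  rfl

/-- The homomorphism `E → [n] → X` sending the generator of `[n]` to a given element. -/
def HomE.pt (z : X) : HomE k n X :=
  (Ind.lift z (xbar_pow_smul_eq_zero le_rfl z) ∘ₗ topPr k n : E k n →ₗ[Lam k n] X)

/-- The endomorphism `E → [n] → E` sending the generator of `[n]` to a given element. -/
def lamE (y : E k n) : A k n := A.of (HomE.pt y).ap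

theorem HomE.pt_ap_topIn (z : X) : (HomE.pt z).ap (topIn k n 1) = z := by
  change Ind.lift z (xbar_pow_smul_eq_zero le_rfl z) (topPr k n (topIn k n 1)) = z
  rw [topPr_topIn, Ind.lift_one]

theorem HomE.map_pt (f : X →ₗ[Lam k n] Y) (z : X) : HomE.map f (HomE.pt z) = HomE.pt (f z) := by
  have : f ∘ₗ Ind.lift z (xbar_pow_smul_eq_zero le_rfl z) =
      Ind.lift (k := k) (n := n) (i := n) (f z) (xbar_pow_smul_eq_zero le_rfl _) := Ind.hom_ext (by simp)
  refine HomE.ext fun y ↦ ?_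
  exact LinearMap.congr_fun this (topPr k n y)

theorem HomE.pt_add (z w : X) : HomE.pt (k := k) (n := n) (z + w) = HomE.pt z + HomE.pt w := by
  have : Ind.lift (k := k) (n := n) (i := n) (z + w) (xbar_pow_smul_eq_zero le_rfl (z + w)) =
      Ind.lift (i := n) z (xbar_pow_smul_eq_zero le_rfl z) +
        Ind.lift w (xbar_pow_smul_eq_zero le_rfl w) := Ind.hom_ext (by simp)
  refine HomE.ext fun y ↦ ?_
  exact LinearMap.congr_fun this (topPr k n y)

theorem HomE.pt_smul (a : Lam k n) (z : X) :
    HomE.pt (a • z) = A.of (k := k) (n := n) (a • LinearMap.id) • HomE.pt (k := k) (n := n) z := by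
  have : Ind.lift (k := k) (n := n) (i := n) (a • z) (xbar_pow_smul_eq_zero le_rfl (a • z)) =
      a • Ind.lift (k := k) (n := n) (i := n) z (xbar_pow_smul_eq_zero le_rfl z) := Ind.hom_ext (by simp)
  refine HomE.ext fun y ↦ ?_
  rw [HomE.ap_smul, A.toEnd_of, LinearMap.smul_apply, map_smul]
  exact LinearMap.congr_fun this (topPr k n y)

theorem HomE.pt_zero : HomE.pt (k := k) (n := n) (0 : X) = 0 := by
  have := HomE.pt_add (k := k) (n := n) (0 : X) 0
  rwa [add_zero, left_eq_add] at this

/-- Acting by λ_y is evaluation at y, with the value h(y) encoded as a map through [n]. Submodules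
of Hom(E, X) can therefore be tested on elements of X. -/
theorem lamE_smul (y : E k n) (h : HomE k n X) : lamE y • h = HomE.pt (h.ap y) :=
  HomE.map_pt h.ap y

theorem lamE_add (y z : E k n) : lamE (y + z) = lamE y + lamE z :=
  congrArg A.of (HomE.pt_add y z)

theorem lamE_zero : lamE (0 : E k n) = 0 := congrArg A.of HomE.pt_zero

theorem lamE_mul (y : E k n) (a : A k n) : lamE y * a = lamE (a.toEnd y) :=
  congrArg A.of (HomE.map_pt a.toEnd y)

theorem lamE_algebraMap_smul (c : k) (y : E k n) :
    lamE (algebraMap k (Lam k n) c • y) = algebraMap k (A k n) c * lamE y := by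
  rw [Algebra.commutes, lamE_mul, A.toEnd_algebraMap]

/-! #### The torsion submodule -/

section tors

variable {M : Type u} [AddCommGroup M] [Module (A k n) M]

/-- P(n) is generated by the projection E → [n], which is fixed by e(n). Hence tM is the submodule
generated by e(n)M, as `tors_le` expresses. -/
theorem P_eq_smul (p : P k n n) :
    p = A.of (topIn k n ∘ₗ p.ap) • e k n ⊤ • (id (topPr k n) : HomE k n (Ind k n n)) := by
  refine HomE.ext fun y ↦ ?_
  rw [HomE.ap_smul, HomE.ap_smul, toEnd_e_top]
  change _ = topPr k n (topIn k n (topPr k n (topIn k n (p.ap y))))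
  rw [topPr_topIn, topPr_topIn]

theorem tors_le {S : Submodule (A k n) M} (hS : ∀ m, e k n ⊤ • m ∈ S) : tors k n M ≤ S := by
  refine iSup_le fun f ↦ ?_
  rintro _ ⟨p, rfl⟩
  rw [P_eq_smul p, map_smul, map_smul]
  exact S.smul_mem _ (hS _)

omit [NeZero n] in
theorem range_le_tors {s : ℕ} (f : (Fin s → P k n n) →ₗ[A k n] M) :
    LinearMap.range f ≤ tors k n M := by
  classical
  rintro _ ⟨p, rfl⟩
  rw [← LinearMap.sum_single_apply (fun _ : Fin s ↦ P k n n) p, map_sum]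
  refine Submodule.sum_mem _ fun i _ ↦ ?_
  exact le_iSup (fun f : P k n n →ₗ[A k n] M ↦ LinearMap.range f)
    (f ∘ₗ LinearMap.single (A k n) (fun _ : Fin s ↦ P k n n) i) ⟨p i, rfl⟩

omit [NeZero n] in
theorem exists_range_eq_tors [IsNoetherian (A k n) M] :
    ∃ (s : ℕ) (f : (Fin s → P k n n) →ₗ[A k n] M), LinearMap.range f = tors k n M := by
  classical
  -- By the ascending chain condition, finitely many of the images already have supremum tM.
  obtain ⟨t, ht⟩ := CompleteLattice.WellFoundedGT.isSupFiniteCompact (Submodule (A k n) M)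
    (Set.range fun f : P k n n →ₗ[A k n] M ↦ LinearMap.range f)
  obtain ⟨ht, hs⟩ := ht
  have hg : ∀ x : t, ∃ f : P k n n →ₗ[A k n] M, LinearMap.range f = x := fun x ↦ ht x.2
  choose g hg using hg
  let f : (Fin t.card → P k n n) →ₗ[A k n] M :=
    LinearMap.lsum (A k n) (fun _ ↦ P k n n) ℕ fun i ↦ g (t.equivFin.symm i)
  refine ⟨t.card, f, le_antisymm (range_le_tors f) ?_⟩
  rw [tors, iSup, hs]
  refine Finset.sup_le fun x hx ↦ ?_
  have := hg ⟨x, hx⟩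
  simp only at this
  rw [id, ← this]
  rintro _ ⟨p, rfl⟩
  refine ⟨Pi.single (t.equivFin ⟨x, hx⟩) p, ?_⟩
  simp [f, LinearMap.lsum_apply, LinearMap.sum_apply, Pi.single_apply, apply_ite]

end tors
end top
end HomModules

/-! #### Torsionless modules -/

section Torsionless

variable {k : Type u} [Field k] {n : ℕ} [NeZero n]
variable {X Y : Type u} [AddCommGroup X] [Module (Lam k n) X] [AddCommGroup Y]
  [Module (Lam k n) Y]
variable {M : Type u} [AddCommGroup M] [Module (A k n) M]

/-- The functional `y ↦ ψ (λ_y m)` on `E`, for a functional `ψ` on `M`. -/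
def evalLam (ψ : M →+ k) (m : M) : E k n →+ k where
  toFun y := ψ (lamE y • m)
  map_zero' := by rw [lamE_zero, zero_smul, map_zero]
  map_add' y z := by rw [lamE_add, add_smul, map_add]

theorem evalLam_algebraMap_smul (ψ : M →+ k)
    (hψ : ∀ (c : k) (m : M), ψ (algebraMap k (A k n) c • m) = c * ψ m) (m : M) (c : k)
    (y : E k n) : evalLam ψ m (algebraMap k (Lam k n) c • y) = c * evalLam ψ m y := by
  change ψ (lamE _ • m) = c * ψ (lamE y • m)
  rw [lamE_algebraMap_smul, mul_smul, hψ]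

/-- The homomorphism `M → P(n)` corresponding to a linear form on `M`. -/
def coind (ψ : M →+ k) (hψ : ∀ (c : k) (m : M), ψ (algebraMap k (A k n) c • m) = c * ψ m) :
    M →ₗ[A k n] P k n n where
  toFun m := frob (evalLam ψ m) (evalLam_algebraMap_smul ψ hψ m)
  map_add' l m := by
    refine HomE.ext fun y ↦ ?_
    change frob (evalLam ψ (l + m)) (evalLam_algebraMap_smul ψ hψ (l + m)) y =
      frob (evalLam ψ l) (evalLam_algebraMap_smul ψ hψ l) y +
        frob (evalLam ψ m) (evalLam_algebraMap_smul ψ hψ m) y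
    rw [frob_apply, frob_apply, frob_apply, ← Finset.sum_add_distrib]
    refine Finset.sum_congr rfl fun i _ ↦ ?_
    rw [← add_smul, ← add_mul, ← map_add]
    congr 3
    exact (congrArg ψ (smul_add _ l m)).trans (map_add ψ _ _)
  map_smul' a m := by
    refine HomE.ext fun y ↦ ?_
    change frob (evalLam ψ (a • m)) (evalLam_algebraMap_smul ψ hψ (a • m)) y =
      frob (evalLam ψ m) (evalLam_algebraMap_smul ψ hψ m) (a.toEnd y)
    rw [frob_apply, frob_apply]
    refine Finset.sum_congr rfl fun i _ ↦ ?_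
    congr 3
    -- Multiplication in A_n is opposite to composition, so λ_y a = λ_{a(y)}, which is exactly
    -- A_n-linearity here.
    change ψ (lamE (xbar k n ^ i • y) • a • m) = ψ (lamE (xbar k n ^ i • a.toEnd y) • m)
    rw [smul_smul, lamE_mul, a.toEnd.map_smul]

theorem coind_ap (ψ : M →+ k)
    (hψ : ∀ (c : k) (m : M), ψ (algebraMap k (A k n) c • m) = c * ψ m) (m : M) :
    (coind ψ hψ m).ap = frob (evalLam ψ m) (evalLam_algebraMap_smul ψ hψ m) := rfl

/-- If f : M → A_n does not kill m, some a = f(m) and y have a(y) ≠ 0, and λ_y a = λ_{a(y)} is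
nonzero. Conversely, a linear form not vanishing on λ_y m gives through `coind` a map M → P(n)
nonzero at m, and P(n) embeds in A_n. So torsionless means that the action of e(n) detects every
nonzero submodule. -/
theorem isTorsionless_iff :
    IsTorsionless (A k n) M ↔ ∀ m : M, m ≠ 0 → ∃ y : E k n, lamE y • m ≠ 0 := by
  constructor
  · intro h m hm
    obtain ⟨f, hf⟩ := h m hm
    have : ∃ y, (f m).toEnd y ≠ 0 := by
      by_contra! H
      exact hf (A.toEnd_injective (LinearMap.ext H))
    obtain ⟨y, hy⟩ := this
    refine ⟨y, fun h0 ↦ hy ?_⟩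
    have h1 : lamE ((f m).toEnd y) = 0 := by
      rw [← lamE_mul, ← smul_eq_mul, ← map_smul, h0, map_zero]
    have h2 := HomE.pt_ap_topIn (k := k) (n := n) ((f m).toEnd y)
    rw [← h2]
    exact LinearMap.congr_fun (congrArg A.toEnd h1) _
  · intro h m hm
    obtain ⟨y, hy⟩ := h m hm
    let _ : Module k M := Module.compHom M (algebraMap k (A k n))
    obtain ⟨ψ, hψ⟩ : ∃ ψ : Module.Dual k M, ψ (lamE y • m) ≠ 0 := by
      by_contra! H
      exact hy ((Module.forall_dual_apply_eq_zero_iff k _).1 H)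
    have hψk : ∀ (c : k) (m : M), ψ.toAddMonoidHom (algebraMap k (A k n) c • m) =
        c * ψ.toAddMonoidHom m := fun c m ↦ ψ.map_smul c m
    obtain ⟨τ, hτ, hτx⟩ := exists_topCoeff k n
    refine ⟨(homESelf k n).toLinearMap ∘ₗ HomE.map (topIn k n) ∘ₗ coind _ hψk, fun h0 ↦ hψ ?_⟩
    have h1 : topIn k n ((coind _ hψk m).ap y) = 0 :=
      LinearMap.congr_fun (congrArg A.toEnd h0) y
    have h2 : (coind _ hψk m).ap y = 0 := by
      rw [← topPr_topIn ((coind _ hψk m).ap y), h1, map_zero]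
    rw [coind_ap] at h2
    have h5 := topCoeff_frob hτ hτx _ (evalLam_algebraMap_smul _ hψk m) y
    rw [h2, map_zero] at h5
    exact h5.symm

omit [NeZero n] in
theorem isTorsionless_of_injective {N : Type u} [AddCommGroup N] [Module (A k n) N]
    (f : M →ₗ[A k n] N) (hf : Function.Injective f) (hN : IsTorsionless (A k n) N) :
    IsTorsionless (A k n) M := fun m hm ↦ by
  obtain ⟨g, hg⟩ := hN (f m) (fun h ↦ hm (hf (h.trans (map_zero f).symm)))
  exact ⟨g ∘ₗ f, hg⟩

omit [NeZero n] in
theorem isTorsionless_pi {ι : Type} {M : ι → Type u} [∀ i, AddCommGroup (M i)]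
    [∀ i, Module (A k n) (M i)] (h : ∀ i, IsTorsionless (A k n) (M i)) :
    IsTorsionless (A k n) (∀ i, M i) := fun m hm ↦ by
  obtain ⟨i, hi⟩ : ∃ i, m i ≠ 0 := by
    by_contra! H
    exact hm (funext H)
  obtain ⟨f, hf⟩ := h i _ hi
  exact ⟨f ∘ₗ LinearMap.proj i, hf⟩

theorem HomE.pt_injective {z : X} (h : HomE.pt (k := k) (n := n) z = 0) : z = 0 := by
  rw [← HomE.pt_ap_topIn (k := k) (n := n) z, h, HomE.ap_zero]

theorem isTorsionless_homE : IsTorsionless (A k n) (HomE k n X) := by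
  rw [isTorsionless_iff]
  intro h hh
  by_contra! H
  refine hh (HomE.ext fun y ↦ HomE.pt_injective (k := k) (n := n) ?_)
  rw [← lamE_smul, H]

theorem isTorsionless_quotient_homInto (Y : Submodule (Lam k n) X) :
    IsTorsionless (A k n) (HomE k n X ⧸ homInto Y) := by
  rw [isTorsionless_iff]
  intro m hm
  obtain ⟨h, rfl⟩ := Submodule.Quotient.mk_surjective _ m
  by_contra! H
  refine hm ((Submodule.Quotient.mk_eq_zero _).2 fun y ↦ ?_)
  have := H y
  rw [← Submodule.Quotient.mk_smul, Submodule.Quotient.mk_eq_zero, lamE_smul] at this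
  have := this (topIn k n 1)
  rwa [HomE.pt_ap_topIn] at this

/-- Take Y to be the z whose map E → [n] → X lies in K. Since λ_y h is the map attached to h(y), the
values of h lie in Y iff all λ_y h lie in K, and for a torsionless quotient this means h ∈ K. -/
theorem exists_eq_homInto {K : Submodule (A k n) (HomE k n X)}
    (hK : IsTorsionless (A k n) (HomE k n X ⧸ K)) :
    ∃ Y : Submodule (Lam k n) X, K = homInto Y := by
  let Y : Submodule (Lam k n) X :=
    { carrier := {z | HomE.pt z ∈ K}
      add_mem' := fun {a b} ha hb ↦ by
        change HomE.pt (a + b) ∈ K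
        rw [HomE.pt_add]
        exact K.add_mem ha hb
      zero_mem' := by
        change HomE.pt 0 ∈ K
        rw [HomE.pt_zero]
        exact K.zero_mem
      smul_mem' := fun a z hz ↦ by
        change HomE.pt (a • z) ∈ K
        rw [HomE.pt_smul]
        exact K.smul_mem _ hz }
  have hY : ∀ z, z ∈ Y ↔ HomE.pt z ∈ K := fun _ ↦ Iff.rfl
  refine ⟨Y, le_antisymm (fun h hh y ↦ ?_) fun h hh ↦ ?_⟩
  · rw [hY, ← lamE_smul]
    exact K.smul_mem _ hh
  · rw [isTorsionless_iff] at hK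
    by_contra hc
    obtain ⟨y, hy⟩ := hK (Submodule.Quotient.mk h) (by rwa [Ne, Submodule.Quotient.mk_eq_zero])
    rw [← Submodule.Quotient.mk_smul, Ne, Submodule.Quotient.mk_eq_zero, lamE_smul] at hy
    exact hy (hh y)

/-- `P(n)` is an injective module. -/
theorem exists_extension_P (K : Submodule (A k n) M) (f : K →ₗ[A k n] P k n n) :
    ∃ g : M →ₗ[A k n] P k n n, ∀ x : K, g x = f x := by
  let _ : Module k M := Module.compHom M (algebraMap k (A k n))
  have : IsScalarTower k (A k n) M := ⟨fun c a m ↦ by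
    rw [Algebra.smul_def, mul_smul]; rfl⟩
  obtain ⟨τ, hτ, hτx⟩ := exists_topCoeff k n
  -- The linear form corresponding to f: evaluate f(m) at the generator of [n] and take the top
  -- coefficient. Linear forms extend over the field k, and `coind` turns the extension back into a
  -- homomorphism.
  let ψ₀ : K.restrictScalars k →ₗ[k] k :=
    { toFun := fun m ↦ τ ((f m).ap (topIn k n 1))
      map_add' := fun l m ↦ by
        have : f (l + m : K) = f (l : K) + f (m : K) := map_add f _ _
        change τ ((f (l + m : K)).ap _) = _
        rw [this, HomE.ap_add, map_add]
      map_smul' := fun c m ↦ by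
        have : f (algebraMap k (A k n) c • m : K) = algebraMap k (A k n) c • f (m : K) :=
          map_smul f _ _
        change τ ((f (algebraMap k (A k n) c • m : K)).ap _) = _
        rw [this, HomE.ap_smul, A.toEnd_algebraMap, map_smul, hτ]
        rfl }
  obtain ⟨ψ, hψ⟩ := LinearMap.exists_extend ψ₀
  have hψk : ∀ (c : k) (m : M), ψ.toAddMonoidHom (algebraMap k (A k n) c • m) =
      c * ψ.toAddMonoidHom m := fun c m ↦ ψ.map_smul c m
  refine ⟨coind _ hψk, fun x ↦ HomE.ext fun y ↦ ?_⟩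
  rw [coind_ap]
  -- Rewriting the value of f as `frob` of its own top coefficient reduces the claim to an equality
  -- of linear forms.
  have h5 : (f x).ap y = frob τ hτ ((f x).ap y) := by rw [frob_topCoeff hτ hτx]; rfl
  rw [h5, frob_apply, frob_apply]
  refine Finset.sum_congr rfl fun i _ ↦ ?_
  congr 3
  rw [← map_smul]
  have h6 : ψ ((lamE (xbar k n ^ i • y) • x : K) : M) = ψ₀ (lamE (xbar k n ^ i • y) • x : K) :=
    LinearMap.congr_fun hψ (lamE (xbar k n ^ i • y) • x : K)
  refine h6.trans ?_
  change τ ((f (lamE (xbar k n ^ i • y) • x : K)).ap _) = _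
  rw [map_smul, lamE_smul, HomE.pt_ap_topIn]

theorem exists_extension_pi_P {s : ℕ} (K : Submodule (A k n) M)
    (f : K →ₗ[A k n] (Fin s → P k n n)) :
    ∃ g : M →ₗ[A k n] (Fin s → P k n n), ∀ x : K, g x = f x := by
  choose g hg using fun i ↦ exists_extension_P K (LinearMap.proj i ∘ₗ f)
  exact ⟨LinearMap.pi g, fun x ↦ funext fun i ↦ hg i x⟩

/-! #### Submodules of free modules -/

variable (k n) in
/-- The embedding of `E^r` into a free `Λ_n`-module. -/
def toFree (r : ℕ) : (Fin r → E k n) →ₗ[Lam k n] (Fin (r * n) → Ind k n n) :=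
  LinearMap.pi fun t ↦ can k n ((finProdFinEquiv.symm t).2 + 1) n ∘ₗ
    LinearMap.proj (finProdFinEquiv.symm t).2 ∘ₗ LinearMap.proj (finProdFinEquiv.symm t).1

omit [NeZero n] in
theorem toFree_injective (r : ℕ) : Function.Injective (toFree k n r) := by
  rw [← LinearMap.ker_eq_bot, LinearMap.ker_eq_bot']
  intro v hv
  ext i j : 2
  have h1 : ∀ p : Fin r × Fin n, can k n (p.2 + 1) n (v p.1 p.2) = 0 := fun p ↦ by
    obtain ⟨t, rfl⟩ := finProdFinEquiv.symm.surjective p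
    exact congrFun hv t
  refine can_injective (k := k) (n := n) (i := j + 1) (j := n) j.2 le_rfl ?_
  rw [Pi.zero_apply, Pi.zero_apply, map_zero]
  exact h1 (i, j)

omit [NeZero n] in
-- Embed E^r in a power of [n] and diagonalize the image of Z. The factor x^c [n] is isomorphic to
-- [n-c], so Z is a direct sum of modules [d] with d ≤ n, each a retract of E.
theorem exists_retract_submodule {r : ℕ} (Z : Submodule (Lam k n) (Fin r → E k n)) :
    ∃ (s : ℕ) (i : Z →ₗ[Lam k n] (Fin s → E k n)) (p : (Fin s → E k n) →ₗ[Lam k n] Z),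
      p ∘ₗ i = LinearMap.id := by
  obtain ⟨θ, c, hc, hY⟩ := exists_diagonal_form (LinearMap.range (toFree k n r ∘ₗ Z.subtype))
  let G : ((t : Fin (r * n)) → Ind k n (n - c t)) →ₗ[Lam k n] (Fin (r * n) → Ind k n n) :=
    θ.symm.toLinearMap ∘ₗ LinearMap.pi fun t ↦ can k n (n - c t) n ∘ₗ LinearMap.proj t
  have hG : Function.Injective G := by
    refine θ.symm.injective.comp fun v w h ↦ funext fun t ↦ ?_
    exact can_injective (Nat.sub_le _ _) le_rfl (congrFun h t)
  have hr : LinearMap.range G = LinearMap.range (toFree k n r ∘ₗ Z.subtype) := by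
    ext v
    rw [hY]
    have : ∀ t, (∃ w, θ v t = xbar k n ^ c t • w) ↔ ∃ w, can k n (n - c t) n w = θ v t := by
      intro t
      rw [mem_range_can, Nat.sub_sub_self (hc t)]
    simp only [this]
    constructor
    · rintro ⟨w, rfl⟩ t
      exact ⟨w t, by simp [G]⟩
    · intro h
      choose w hw using h
      refine ⟨w, θ.injective ?_⟩
      simp only [G, LinearMap.comp_apply, LinearEquiv.coe_coe, LinearEquiv.apply_symm_apply]
      exact funext hw
  let Φ : Z ≃ₗ[Lam k n] ((t : Fin (r * n)) → Ind k n (n - c t)) :=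
    LinearEquiv.ofInjective (toFree k n r ∘ₗ Z.subtype)
      ((toFree_injective r).comp Subtype.val_injective) ≪≫ₗ
      LinearEquiv.ofEq _ _ hr.symm ≪≫ₗ (LinearEquiv.ofInjective G hG).symm
  choose i p hip using fun t ↦ exists_retract_ind (k := k) (Nat.sub_le n (c t))
  refine ⟨r * n, (LinearMap.pi fun t ↦ i t ∘ₗ LinearMap.proj t) ∘ₗ Φ.toLinearMap,
    Φ.symm.toLinearMap ∘ₗ LinearMap.pi fun t ↦ p t ∘ₗ LinearMap.proj t, LinearMap.ext fun z ↦ ?_⟩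
  change Φ.symm (fun t ↦ p t (i t (Φ z t))) = z
  have : (fun t ↦ p t (i t (Φ z t))) = Φ z := funext fun t ↦ LinearMap.congr_fun (hip t) _
  rw [this, LinearEquiv.symm_apply_apply]

/-- Hom(E, Z) is a retract of a free module since Z is a retract of some E^s. This bounds the
projective dimension of finitely generated torsionless modules by 1. -/
theorem projective_homInto {r : ℕ} (Z : Submodule (Lam k n) (Fin r → E k n)) :
    Module.Projective (A k n) (homInto Z) := by
  obtain ⟨s, i, p, hip⟩ := exists_retract_submodule Z
  have : Module.Projective (A k n) (HomE k n (Fin s → E k n)) :=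
    Module.Projective.of_equiv (homEFree k n s).symm
  let f : homInto Z →ₗ[A k n] HomE k n Z :=
    { toFun := fun h ↦ h.1.ap.codRestrict Z h.2
      map_add' := fun _ _ ↦ rfl
      map_smul' := fun _ _ ↦ rfl }
  let g : HomE k n Z →ₗ[A k n] homInto Z :=
    (HomE.map Z.subtype).codRestrict _ fun h y ↦ (h.ap y).2
  refine Module.Projective.of_split (HomE.map i ∘ₗ f) (g ∘ₗ HomE.map p)
    (LinearMap.ext fun h ↦ Subtype.ext (HomE.ext fun y ↦ ?_))
  exact congrArg Subtype.val (LinearMap.congr_fun hip ⟨h.1.ap y, h.2 y⟩)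

omit [NeZero n] in
-- For d < n this is the summand T(d+1); for d = n the quotient is zero.
theorem exists_retract_quotient {d : ℕ} (hd : d ≤ n) :
    ∃ (i : (P k n n ⧸ LinearMap.range (HomE.map (can k n d n))) →ₗ[A k n] T k n)
      (p : T k n →ₗ[A k n] P k n n ⧸ LinearMap.range (HomE.map (can k n d n))),
      p ∘ₗ i = LinearMap.id := by
  rcases hd.lt_or_eq with h | rfl
  · refine ⟨LinearMap.single (A k n)
      (fun i : Fin n ↦ P k n n ⧸ LinearMap.range (HomE.map (can k n (i : ℕ) n))) ⟨d, h⟩,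
      LinearMap.proj (⟨d, h⟩ : Fin n), LinearMap.ext fun z ↦ ?_⟩
    simp
  · refine ⟨0, 0, LinearMap.ext fun z ↦ ?_⟩
    obtain ⟨h, rfl⟩ := Submodule.Quotient.mk_surjective _ z
    have : (Submodule.Quotient.mk h : P k d d ⧸ LinearMap.range (HomE.map (can k d d d))) = 0 := by
      rw [Submodule.Quotient.mk_eq_zero]
      exact ⟨HomE.map (can k d d d) h, HomE.ext fun y ↦ can_can_of_eq rfl _⟩
    simp [this]

omit [NeZero n] in
theorem mem_range_map_can {d : ℕ} (hd : d ≤ n) (h : P k n n) :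
    h ∈ LinearMap.range (HomE.map (can k n d n)) ↔ ∀ y, ∃ w, h.ap y = xbar k n ^ (n - d) • w := by
  rw [range_map (can_injective hd le_rfl), mem_homInto]
  exact forall_congr' fun y ↦ mem_range_can _

omit [NeZero n] in
-- After diagonalizing, Y is the product of the x^(c t) [n], the images of the inclusions [n - c t]
-- → [n]. The quotient is then the product of the P(n)/P(n - c t), each a retract of T.
theorem exists_retract_quotient_homInto {s : ℕ} (Y : Submodule (Lam k n) (Fin s → Ind k n n)) :
    ∃ (i : (HomE k n (Fin s → Ind k n n) ⧸ homInto Y) →ₗ[A k n] (Fin s → T k n))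
      (p : (Fin s → T k n) →ₗ[A k n] HomE k n (Fin s → Ind k n n) ⧸ homInto Y),
      p ∘ₗ i = LinearMap.id := by
  obtain ⟨θ, c, hc, hY⟩ := exists_diagonal_form Y
  let Ψ : HomE k n (Fin s → Ind k n n) →ₗ[A k n]
      ((t : Fin s) → P k n n ⧸ LinearMap.range (HomE.map (can k n (n - c t) n))) :=
    LinearMap.pi fun t ↦ Submodule.mkQ _ ∘ₗ HomE.map (LinearMap.proj t ∘ₗ θ.toLinearMap)
  have hΨ : Function.Surjective Ψ := by
    intro z
    choose w hw using fun t ↦ Submodule.Quotient.mk_surjective _ (z t)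
    let h : HomE k n (Fin s → Ind k n n) := LinearMap.pi fun t ↦ (w t).ap
    refine ⟨HomE.map θ.symm.toLinearMap h, funext fun t ↦ ?_⟩
    rw [← hw]
    change Submodule.Quotient.mk (HomE.map (LinearMap.proj t ∘ₗ θ.toLinearMap)
      (HomE.map θ.symm.toLinearMap h)) = _
    congr 1
    refine HomE.ext fun y ↦ ?_
    simp only [HomE.ap_map, LinearMap.comp_apply, LinearEquiv.coe_coe,
      LinearEquiv.apply_symm_apply]
    rfl
  have hk : LinearMap.ker Ψ = homInto Y := by
    ext h
    rw [LinearMap.mem_ker, mem_homInto]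
    have : Ψ h = 0 ↔ ∀ t, HomE.map (LinearMap.proj t ∘ₗ θ.toLinearMap) h ∈
        LinearMap.range (HomE.map (can k n (n - c t) n)) := by
      simp only [← Submodule.Quotient.mk_eq_zero]
      exact funext_iff
    rw [this]
    simp only [mem_range_map_can (Nat.sub_le _ _), hY, Nat.sub_sub_self (hc _)]
    exact forall_comm
  let Φ := (Submodule.quotEquivOfEq _ _ hk.symm) ≪≫ₗ Ψ.quotKerEquivOfSurjective hΨ
  choose i p hip using fun t ↦ exists_retract_quotient (k := k) (Nat.sub_le n (c t))
  refine ⟨(LinearMap.pi fun t ↦ i t ∘ₗ LinearMap.proj t) ∘ₗ Φ.toLinearMap,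
    Φ.symm.toLinearMap ∘ₗ LinearMap.pi fun t ↦ p t ∘ₗ LinearMap.proj t, LinearMap.ext fun z ↦ ?_⟩
  change Φ.symm (fun t ↦ p t (i t (Φ z t))) = z
  have : (fun t ↦ p t (i t (Φ z t))) = Φ z := funext fun t ↦ LinearMap.congr_fun (hip t) _
  rw [this, LinearEquiv.symm_apply_apply]

theorem isTorsionless_T : IsTorsionless (A k n) (T k n) := by
  refine isTorsionless_pi fun i ↦ ?_
  rw [range_map (can_injective i.2.le le_rfl)]
  exact isTorsionless_quotient_homInto _

omit [NeZero n] in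
theorem tors_T : tors k n (T k n) = ⊤ := by
  rw [eq_top_iff]
  let f : (Fin n → P k n n) →ₗ[A k n] T k n :=
    LinearMap.pi fun i ↦ Submodule.mkQ _ ∘ₗ LinearMap.proj i
  refine le_trans (fun z _ ↦ ?_) (range_le_tors f)
  choose w hw using fun t ↦ Submodule.Quotient.mk_surjective _ (z t)
  exact ⟨w, funext hw⟩

end Torsionless

/-! #### Torsionless modules modulo torsion -/

section Lifting

variable {k : Type u} [Field k] {n : ℕ}
variable {X : Type u} [AddCommGroup X] [Module (Lam k n) X]
variable {M N : Type u} [AddCommGroup M] [Module (A k n) M] [AddCommGroup N] [Module (A k n) N]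

variable (k n X) in
/-- `Hom(E, -)` commutes with finite products. -/
def homEPi (r : ℕ) : HomE k n (Fin r → X) ≃ₗ[A k n] (Fin r → HomE k n X) where
  toFun h i := HomE.map (LinearMap.proj i) h
  invFun h := LinearMap.pi fun i ↦ (h i).ap
  map_add' _ _ := rfl
  map_smul' _ _ := rfl
  left_inv _ := rfl
  right_inv _ := rfl

/-- The Yoneda lemma for `E^s`. -/
theorem exists_eq_map {s : ℕ} (σ : HomE k n (Fin s → E k n) →ₗ[A k n] HomE k n X) :
    ∃ g : (Fin s → E k n) →ₗ[Lam k n] X, σ = HomE.map g := by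
  -- The coordinate inclusions form the standard basis of the free module Hom(E, E^s), so σ is
  -- determined by their images.
  let b (i : Fin s) : HomE k n (Fin s → E k n) := LinearMap.single (Lam k n) (fun _ ↦ E k n) i
  have hb : ∀ h, h = ∑ i, homEFree k n s h i • b i := by
    intro h
    apply (homEFree k n s).injective
    rw [map_sum]
    have : ∀ i, homEFree k n s (b i) = Pi.single i 1 := by
      intro i
      ext j
      apply A.toEnd_injective
      refine LinearMap.ext fun y ↦ ?_
      rw [homEFree_apply_toEnd]
      change (Pi.single i y : Fin s → E k n) j = _
      by_cases hij : j = i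
      · subst hij
        rw [Pi.single_eq_same, Pi.single_eq_same]
        rfl
      · rw [Pi.single_eq_of_ne hij, Pi.single_eq_of_ne hij]
        rfl
    simp only [map_smul, this]
    exact (Finset.univ_sum_single _).symm.trans (by simp [← Pi.single_smul])
  refine ⟨∑ i, (σ (b i)).ap ∘ₗ LinearMap.proj i, LinearMap.ext fun h ↦ ?_⟩
  conv_lhs => rw [hb h]
  rw [map_sum]
  simp only [map_smul]
  refine HomE.ext fun y ↦ ?_
  rw [HomE.ap_map, LinearMap.sum_apply]
  have hs : ∀ (t : Finset (Fin s)) (F : Fin s → HomE k n X), (∑ i ∈ t, F i).ap y =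
      ∑ i ∈ t, (F i).ap y := fun t F ↦
    map_sum (⟨⟨fun h : HomE k n X ↦ h.ap y, rfl⟩, fun _ _ ↦ rfl⟩ : HomE k n X →+ X) _ _
  rw [hs]
  rfl

variable [NeZero n]

/-- This is the vanishing of Ext¹(M, tN) made explicit. A lift on a free cover of M is corrected by
a map into tN until it kills the kernel of the cover. -/
theorem exists_lift_of_isTorsionless [Module.Finite (A k n) M] [IsNoetherian (A k n) N]
    (hM : IsTorsionless (A k n) M) (f : M →ₗ[A k n] N ⧸ tors k n N) :
    ∃ g : M →ₗ[A k n] N, (tors k n N).mkQ ∘ₗ g = f := by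
  obtain ⟨r, π₀, hπ₀⟩ := Module.Finite.exists_fin' (A k n) M
  let π : HomE k n (Fin r → E k n) →ₗ[A k n] M := π₀ ∘ₗ (homEFree k n r).toLinearMap
  have hπ : Function.Surjective π := hπ₀.comp (homEFree k n r).surjective
  have : Module.Projective (A k n) (HomE k n (Fin r → E k n)) :=
    Module.Projective.of_equiv (homEFree k n r).symm
  obtain ⟨a, ha⟩ := Module.projective_lifting_property (tors k n N).mkQ (f ∘ₗ π)
    (Submodule.mkQ_surjective _)
  let K := LinearMap.ker π
  obtain ⟨Z, hZ⟩ := exists_eq_homInto (K := K) (isTorsionless_of_injective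
    (π.quotKerEquivOfSurjective hπ).toLinearMap (π.quotKerEquivOfSurjective hπ).injective hM)
  have : Module.Projective (A k n) K := hZ ▸ projective_homInto Z
  obtain ⟨s, ρ, hρ⟩ := exists_range_eq_tors (k := k) (n := n) (M := N)
  have haK : ∀ x : K, a x ∈ LinearMap.range ρ := by
    intro x
    rw [hρ, ← Submodule.Quotient.mk_eq_zero, ← Submodule.mkQ_apply, ← LinearMap.comp_apply, ha,
      LinearMap.comp_apply, x.2, map_zero]
  -- On K the lift a has values in tN. Projectivity of K factors it through P(n)^s, and injectivity
  -- of P(n) extends the factor c to the whole cover; a - ρ c still lifts f and vanishes on K.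
  obtain ⟨b, hb⟩ := Module.projective_lifting_property ρ.rangeRestrict
    ((a ∘ₗ K.subtype).codRestrict _ haK) ρ.surjective_rangeRestrict
  obtain ⟨c, hc⟩ := exists_extension_pi_P K b
  have hk : K ≤ LinearMap.ker (a - ρ ∘ₗ c) := by
    intro x hx
    rw [LinearMap.mem_ker, LinearMap.sub_apply, LinearMap.comp_apply, hc ⟨x, hx⟩, sub_eq_zero]
    exact (congrArg Subtype.val (LinearMap.congr_fun hb ⟨x, hx⟩)).symm
  refine ⟨K.liftQ _ hk ∘ₗ (π.quotKerEquivOfSurjective hπ).symm.toLinearMap, ?_⟩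
  refine LinearMap.ext fun m ↦ ?_
  obtain ⟨h, rfl⟩ := hπ m
  have h1 : (π.quotKerEquivOfSurjective hπ).symm (π h) = Submodule.Quotient.mk h := by
    rw [LinearEquiv.symm_apply_eq]
    rfl
  have h2 : K.liftQ _ hk (Submodule.Quotient.mk h) = a h - ρ (c h) := rfl
  rw [LinearMap.comp_apply, LinearMap.comp_apply, LinearEquiv.coe_coe, h1, h2, map_sub]
  have h3 : (tors k n N).mkQ (ρ (c h)) = 0 := by
    rw [Submodule.mkQ_apply, Submodule.Quotient.mk_eq_zero, ← hρ]
    exact ⟨_, rfl⟩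
  rw [h3, sub_zero]
  exact LinearMap.congr_fun ha h

/-- The map factors through tN. As a submodule of N this is torsionless, and it is a quotient of
Hom(E, [n]^s), so it is a retract of a power of T. -/
theorem exists_factorization_of_range_le [IsNoetherian (A k n) N]
    (hN : IsTorsionless (A k n) N) (f : M →ₗ[A k n] N) (hf : ∀ m, f m ∈ tors k n N) :
    ∃ (s : ℕ) (i : M →ₗ[A k n] (Fin s → T k n)) (p : (Fin s → T k n) →ₗ[A k n] N),
      p ∘ₗ i = f := by
  obtain ⟨s, ρ₀, hρ₀⟩ := exists_range_eq_tors (k := k) (n := n) (M := N)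
  let ρ : HomE k n (Fin s → Ind k n n) →ₗ[A k n] N := ρ₀ ∘ₗ (homEPi k n (Ind k n n) s).toLinearMap
  have hρ : LinearMap.range ρ = tors k n N := by
    rw [← hρ₀, LinearMap.range_comp_of_range_eq_top _ (LinearEquiv.range _)]
  have hK : IsTorsionless (A k n) (HomE k n (Fin s → Ind k n n) ⧸ LinearMap.ker ρ) :=
    isTorsionless_of_injective ((LinearMap.range ρ).subtype ∘ₗ ρ.quotKerEquivRange.toLinearMap)
      (Subtype.val_injective.comp ρ.quotKerEquivRange.injective) hN
  obtain ⟨Y, hY⟩ := exists_eq_homInto hK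
  obtain ⟨i, p, hip⟩ := exists_retract_quotient_homInto Y
  let Φ : (HomE k n (Fin s → Ind k n n) ⧸ homInto Y) ≃ₗ[A k n] LinearMap.range ρ :=
    Submodule.quotEquivOfEq _ _ hY.symm ≪≫ₗ ρ.quotKerEquivRange
  refine ⟨s, i ∘ₗ Φ.symm.toLinearMap ∘ₗ f.codRestrict _ (fun m ↦ hρ ▸ hf m),
    (LinearMap.range ρ).subtype ∘ₗ Φ.toLinearMap ∘ₗ p, LinearMap.ext fun m ↦ ?_⟩
  simp only [LinearMap.comp_apply, LinearEquiv.coe_coe]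
  rw [← LinearMap.comp_apply p i, hip, LinearMap.id_apply, LinearEquiv.apply_symm_apply]
  rfl

theorem exists_torsionless_cover (U : Type u) [AddCommGroup U] [Module (A k n) U]
    [Module.Finite (A k n) U] (hU : ∀ u : U, e k n ⊤ • u = 0) :
    ∃ (X : Type u) (_ : AddCommGroup X) (_ : Module (Lam k n) X)
      (Y : Submodule (Lam k n) X) (g : (HomE k n X ⧸ homInto Y) →ₗ[A k n] U),
      Module.Finite (A k n) (HomE k n X) ∧ Function.Surjective g ∧
        LinearMap.ker g = tors k n (HomE k n X ⧸ homInto Y) := by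
  obtain ⟨r, f₀, hf₀⟩ := Module.Finite.exists_fin' (A k n) U
  let f : HomE k n (Fin r → E k n) →ₗ[A k n] U := f₀ ∘ₗ (homEFree k n r).toLinearMap
  have hf : Function.Surjective f := hf₀.comp (homEFree k n r).surjective
  obtain ⟨s, σ₀, hσ₀⟩ := Module.Finite.exists_fin' (A k n) (LinearMap.ker f)
  obtain ⟨g₀, hg₀⟩ := exists_eq_map
    ((LinearMap.ker f).subtype ∘ₗ σ₀ ∘ₗ (homEFree k n s).toLinearMap)
  have hker : ∀ h, f h = 0 ↔ ∃ z, HomE.map g₀ z = h := by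
    intro h
    rw [← hg₀]
    constructor
    · intro hh
      obtain ⟨z, hz⟩ := hσ₀ ⟨h, hh⟩
      exact ⟨(homEFree k n s).symm z, by simp [hz]⟩
    · rintro ⟨z, rfl⟩
      exact (σ₀ (homEFree k n s z)).2
  -- The second factor is there to make (g₀, `toFree`) injective, so that its cokernel under Hom(E,
  -- -) is torsionless even when g₀ is not injective.
  let X := (Fin r → E k n) × (Fin (s * n) → Ind k n n)
  let g : (Fin s → E k n) →ₗ[Lam k n] X := g₀.prod (toFree k n s)
  have hg : Function.Injective g := fun v w h ↦ toFree_injective s (congrArg Prod.snd h)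
  let fX : HomE k n X →ₗ[A k n] U := f ∘ₗ HomE.map (LinearMap.fst (Lam k n) _ _)
  have hle : homInto (LinearMap.range g) ≤ LinearMap.ker fX := by
    rw [← range_map hg]
    rintro _ ⟨z, rfl⟩
    exact (hker _).2 ⟨z, rfl⟩
  let inr : HomE k n (Fin (s * n) → Ind k n n) →ₗ[A k n] HomE k n X :=
    HomE.map (LinearMap.inr (Lam k n) _ _)
  refine ⟨X, inferInstance, inferInstance, LinearMap.range g, Submodule.liftQ _ fX hle,
    ?_, ?_, le_antisymm ?_ ?_⟩
  · have := Module.Finite.of_surjective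
      ((HomE.map (LinearMap.inl (Lam k n) _ _) : HomE k n (Fin r → E k n) →ₗ[A k n] HomE k n X).coprod
        inr) ?_
    · exact this
    · intro h
      refine ⟨(HomE.map (LinearMap.fst (Lam k n) _ _) h, HomE.map (LinearMap.snd (Lam k n) _ _) h),
        HomE.ext fun y ↦ ?_⟩
      exact Prod.ext (add_zero _) (zero_add _)
  · intro u
    obtain ⟨h, rfl⟩ := hf u
    exact ⟨Submodule.Quotient.mk (HomE.map (LinearMap.inl (Lam k n) _ _) h), rfl⟩
  · intro m hm
    obtain ⟨h, rfl⟩ := Submodule.Quotient.mk_surjective _ m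
    obtain ⟨z, hz⟩ := (hker _).1 (show f (HomE.map (LinearMap.fst (Lam k n) _ _) h) = 0 from hm)
    -- Subtracting the image of z clears the first component. What remains comes from a power of
    -- P(n), hence is torsion.
    let w := HomE.map (LinearMap.snd (Lam k n) _ _) (h - HomE.map g z)
    have h1 : h = HomE.map g z + inr w := by
      rw [← sub_eq_iff_eq_add']
      refine HomE.ext fun y ↦ Prod.ext ?_ rfl
      have h2 := congrArg (fun q ↦ HomE.ap q y) hz
      change (h.ap y).1 - g₀ (z.ap y) = 0
      rw [sub_eq_zero]
      exact h2.symm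
    have h3 : (Submodule.Quotient.mk h : HomE k n X ⧸ homInto (LinearMap.range g)) =
        Submodule.mkQ _ (inr w) := by
      rw [Submodule.mkQ_apply, Submodule.Quotient.eq, h1, add_sub_cancel_right, ← range_map hg]
      exact ⟨z, rfl⟩
    rw [h3]
    refine range_le_tors (Submodule.mkQ _ ∘ₗ inr ∘ₗ
      (homEPi k n (Ind k n n) (s * n)).symm.toLinearMap) ⟨homEPi k n (Ind k n n) (s * n) w, ?_⟩
    rfl
  · refine tors_le fun m ↦ ?_
    rw [LinearMap.mem_ker, map_smul, hU]

end Lifting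

/-! ### The factor category -/

section Equivalence

variable {k : Type u} [Field k] {n : ℕ} [NeZero n]

omit [NeZero n] in
theorem Del.proj_eq_zero_iff {M : Type u} [AddCommGroup M] [Module (A k n) M] (m : M) :
    Del.proj k n M m = 0 ↔ m ∈ tors k n M := Submodule.Quotient.mk_eq_zero _

variable (φ : Preproj k (n - 1) ≃ₐ[k] Abar k n)

theorem deltaPi_map_eq_iff {X Y : FCat k n} (f g : X ⟶ Y) :
    (deltaPi φ).map f = (deltaPi φ).map g ↔ ∀ x : X.obj, (f - g).hom.hom x ∈ tors k n Y.obj := by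
  have h0 : ∀ x : X.obj, (f - g).hom.hom x = f.hom.hom x - g.hom.hom x := fun _ ↦ rfl
  have h1 : ∀ x : X.obj, (f - g).hom.hom x ∈ tors k n Y.obj ↔
      ((deltaPi φ).map f).hom.hom (Del.proj k n X.obj x) =
        ((deltaPi φ).map g).hom.hom (Del.proj k n X.obj x) := by
    intro x
    rw [h0, ← Del.proj_eq_zero_iff, map_sub, sub_eq_zero]
    rfl
  simp only [h1]
  constructor
  · intro h x
    rw [h]
  · intro h
    apply ObjectProperty.hom_ext
    apply ModuleCat.hom_ext
    refine LinearMap.ext fun y ↦ ?_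
    obtain ⟨x, rfl⟩ := Del.proj_surjective (k := k) (n := n) X.obj y
    exact h x

variable (k n) in
theorem torsionlessFin_T : torsionlessFin k n (ModuleCat.of _ (T k n)) :=
  ⟨finLen_of_finite, isTorsionless_T⟩

variable (k n) in
/-- The characteristic tilting module, as an object of `F(n)`. -/
def TObj : FCat k n := ⟨ModuleCat.of _ (T k n), torsionlessFin_T k n⟩

variable (k n) in
/-- The direct sum of `s` copies of the characteristic tilting module. -/
def TPow (s : ℕ) : FCat k n :=
  ⟨ModuleCat.of _ (Fin s → T k n), finLen_of_finite, isTorsionless_pi fun _ ↦ isTorsionless_T⟩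

variable (k n) in
theorem isDirectSumOf_TPow (s : ℕ) :
    IsDirectSumOf (ObjectProperty.singleton (TObj k n)) (TPow k n s) := by
  let b : Bicone (fun _ : Fin s ↦ TObj k n) :=
    { pt := TPow k n s
      π := fun i ↦ ObjectProperty.homMk (ModuleCat.ofHom (LinearMap.proj i))
      ι := fun i ↦ ObjectProperty.homMk
        (ModuleCat.ofHom (LinearMap.single (A k n) (fun _ ↦ T k n) i))
      ι_π := fun i j ↦ by
        apply ObjectProperty.hom_ext
        apply ModuleCat.hom_ext
        refine LinearMap.ext fun x ↦ ?_
        change (Pi.single i x : Fin s → T k n) j = _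
        by_cases h : i = j
        · subst h
          rw [dif_pos rfl]
          exact Pi.single_eq_same (M := fun _ : Fin s ↦ T k n) i x
        · rw [dif_neg h]
          exact Pi.single_eq_of_ne (M := fun _ : Fin s ↦ T k n) (Ne.symm h) x }
  refine ⟨s, fun _ ↦ TObj k n, b, fun _ ↦ (ObjectProperty.singleton_iff _ _).2 rfl,
    ⟨isBilimitOfTotal b ?_⟩, rfl⟩
  apply ObjectProperty.hom_ext
  apply ModuleCat.hom_ext
  refine LinearMap.ext fun x ↦ ?_
  let ev : (TPow k n s ⟶ TPow k n s) →+ (Fin s → T k n) :=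
    { toFun := fun f ↦ f.hom.hom x
      map_zero' := rfl
      map_add' := fun _ _ ↦ rfl }
  change ev (∑ j, b.π j ≫ b.ι j) = x
  rw [map_sum]
  exact Finset.univ_sum_single x

/-- T equals its own torsion, and homomorphisms carry torsion into torsion. -/
theorem mem_tors_of_inIdeal {X Y : FCat k n} {f : X ⟶ Y}
    (hf : InIdeal (ObjectProperty.singleton (TObj k n)) f) (x : X.obj) :
    f.hom.hom x ∈ tors k n Y.obj := by
  obtain ⟨Z, g, h, ⟨r, W, b, hW, ⟨hb⟩, rfl⟩, rfl⟩ := hf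
  let ev : (X ⟶ Y) →+ Y.obj :=
    { toFun := fun f ↦ f.hom.hom x
      map_zero' := rfl
      map_add' := fun _ _ ↦ rfl }
  have h1 : g ≫ h = ∑ j, g ≫ (b.π j ≫ b.ι j) ≫ h := by
    conv_lhs => rw [← Category.id_comp h, ← IsBilimit.total hb]
    rw [Preadditive.sum_comp, Preadditive.comp_sum]
  change ev (g ≫ h) ∈ _
  rw [h1, map_sum]
  refine Submodule.sum_mem _ fun j _ ↦ ?_
  have h2 : ∀ W : FCat k n, ObjectProperty.singleton (TObj k n) W → ∀ w : W.obj,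
      w ∈ tors k n W.obj := by
    intro W hW w
    obtain rfl := (ObjectProperty.singleton_iff _ _).1 hW
    change w ∈ tors k n (T k n)
    rw [tors_T]
    trivial
  exact tors_le_comap (b.ι j ≫ h).hom.hom (h2 _ (hW j) ((g ≫ b.π j).hom.hom x))

theorem inIdeal_of_mem_tors {X Y : FCat k n} {f : X ⟶ Y}
    (hf : ∀ x, f.hom.hom x ∈ tors k n Y.obj) :
    InIdeal (ObjectProperty.singleton (TObj k n)) f := by
  have := (isFiniteLength_iff_isNoetherian_isArtinian.1 Y.property.1).1
  obtain ⟨s, i, p, hip⟩ := exists_factorization_of_range_le Y.property.2 f.hom.hom hf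
  refine ⟨TPow k n s, ObjectProperty.homMk (ModuleCat.ofHom i),
    ObjectProperty.homMk (ModuleCat.ofHom p), isDirectSumOf_TPow k n s, ?_⟩
  apply ObjectProperty.hom_ext
  apply ModuleCat.hom_ext
  exact hip

theorem deltaPi_map_eq_iff_idealRel {X Y : FCat k n} (f g : X ⟶ Y) :
    (deltaPi φ).map f = (deltaPi φ).map g ↔
      idealRel (ObjectProperty.singleton (TObj k n)) f g := by
  rw [deltaPi_map_eq_iff]
  exact ⟨inIdeal_of_mem_tors, mem_tors_of_inIdeal⟩

theorem toAbar_eq (a : A k n) : φ (φ.symm (toAbar k n a)) = toAbar k n a :=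
  AlgEquiv.apply_symm_apply _ _

instance deltaPi_full : (deltaPi φ).Full where
  map_surjective {X Y} h := by
    have := (isFiniteLength_iff_isNoetherian_isArtinian.1 X.property.1).1
    have := (isFiniteLength_iff_isNoetherian_isArtinian.1 Y.property.1).1
    -- The composite of X → X/tX with h. It is A_n-linear since a acts on both quotients through its
    -- class in A_n/⟨e(n)⟩.
    let f : X.obj →ₗ[A k n] Y.obj ⧸ tors k n Y.obj :=
      { toFun := fun x ↦ h.hom.hom (Del.proj k n X.obj x)
        map_add' := fun x y ↦ by
          rw [map_add]
          exact h.hom.hom.map_add _ _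
        map_smul' := fun a x ↦ by
          rw [Del.proj_smul, ← toAbar_eq φ]
          have h1 := h.hom.hom.map_smul (φ.symm (toAbar k n a)) (Del.proj k n X.obj x)
          refine h1.trans ?_
          obtain ⟨y, hy⟩ := Del.proj_surjective (k := k) (n := n) Y.obj
            (h.hom.hom (Del.proj k n X.obj x))
          rw [← hy]
          change φ (φ.symm (toAbar k n a)) • Del.proj k n Y.obj y = _
          rw [toAbar_eq]
          rfl }
    obtain ⟨g, hg⟩ := exists_lift_of_isTorsionless X.property.2 f
    refine ⟨ObjectProperty.homMk (ModuleCat.ofHom g), ?_⟩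
    apply ObjectProperty.hom_ext
    apply ModuleCat.hom_ext
    refine LinearMap.ext fun y ↦ ?_
    obtain ⟨x, rfl⟩ := Del.proj_surjective (k := k) (n := n) X.obj y
    exact LinearMap.congr_fun hg x

/-- An `A_n`-homomorphism to a `Π_{n-1}`-module induces an isomorphism on `δ` if it is surjective
and its kernel is the torsion submodule. -/
def deltaPiIso (M : FCat k n) (U : Type u) [AddCommGroup U] [Module (Preproj k (n - 1)) U]
    (g : M.obj →+ U) (hg : Function.Surjective g)
    (hs : ∀ a m, g (a • m) = φ.symm (toAbar k n a) • g m)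
    (hk : ∀ m, g m = 0 ↔ m ∈ tors k n M.obj) :
    ((deltaPi φ).obj M).obj ≅ ModuleCat.of (Preproj k (n - 1)) U := by
  have hp : ∀ m, Del.proj k n M.obj m = 0 ↔ m ∈ tors k n M.obj := Del.proj_eq_zero_iff
  let f₀ : Del k n M.obj →+ U := (Del.proj k n M.obj).liftOfSurjective (Del.proj_surjective _)
    ⟨g, fun m hm ↦ (hk m).2 ((hp m).1 hm)⟩
  have hf₀ : ∀ m, f₀ (Del.proj k n M.obj m) = g m := fun m ↦
    (Del.proj k n M.obj).liftOfRightInverse_comp_apply _ _ ⟨g, _⟩ m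
  let f : ((deltaPi φ).obj M).obj →ₗ[Preproj k (n - 1)] U :=
    { toFun := f₀
      map_add' := f₀.map_add
      map_smul' := fun p y ↦ by
        obtain ⟨m, rfl⟩ := Del.proj_surjective (k := k) (n := n) M.obj y
        obtain ⟨a, ha⟩ := Ideal.Quotient.mk_surjective (φ p)
        change f₀ (φ p • Del.proj k n M.obj m) = p • f₀ (Del.proj k n M.obj m)
        change toAbar k n a = φ p at ha
        rw [← ha, ← Del.proj_smul, hf₀, hf₀, hs, ha, AlgEquiv.symm_apply_apply] }
  refine (LinearEquiv.ofBijective f ⟨?_, ?_⟩).toModuleIso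
  · rw [← LinearMap.ker_eq_bot, LinearMap.ker_eq_bot']
    intro y hy
    obtain ⟨m, rfl⟩ := Del.proj_surjective (k := k) (n := n) M.obj y
    refine (hp m).2 ((hk m).1 ?_)
    rw [← hf₀]
    exact hy
  · intro u
    obtain ⟨m, rfl⟩ := hg u
    exact ⟨Del.proj k n M.obj m, hf₀ m⟩

theorem toAbar_e_top : toAbar k n (e k n ⊤) = 0 :=
  Ideal.Quotient.eq_zero_iff_mem.2 (TwoSidedIdeal.subset_span rfl)

instance deltaPi_essSurj : (deltaPi φ).EssSurj where
  mem_essImage U := by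
    have hU := (isFiniteLength_iff_isNoetherian_isArtinian.1 U.property).1
    -- U is inflated along the surjection A_n → Π_{n-1}; on the result e(n) acts as zero, as the
    -- covering lemma requires.
    let σ : A k n →+* Preproj k (n - 1) := (φ.symm.toAlgHom.toRingHom).comp (toAbar k n)
    have hσ : Function.Surjective σ := φ.symm.surjective.comp Ideal.Quotient.mk_surjective
    let _ : Module (A k n) U.obj := Module.compHom U.obj σ
    have hsm : ∀ (a : A k n) (u : U.obj), a • u = σ a • u := fun _ _ ↦ rfl
    have : Module.Finite (A k n) U.obj := by
      obtain ⟨s, f, hf⟩ := Module.Finite.exists_fin' (Preproj k (n - 1)) U.obj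
      let g : (Fin s → A k n) →ₗ[A k n] U.obj :=
        { toFun := fun v ↦ f (σ ∘ v)
          map_add' := fun v w ↦ by
            rw [← map_add]
            congr 1
            ext i
            exact map_add σ _ _
          map_smul' := fun a v ↦ by
            rw [RingHom.id_apply, hsm, ← map_smul]
            congr 1
            ext i
            exact map_mul σ _ _ }
      refine Module.Finite.of_surjective g fun u ↦ ?_
      obtain ⟨w, rfl⟩ := hf u
      choose v hv using fun i ↦ hσ (w i)
      exact ⟨v, congrArg f (funext hv)⟩
    obtain ⟨X, _, _, Y, g, _, hg, hk⟩ := exists_torsionless_cover (k := k) (n := n) U.obj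
      fun u ↦ by
        rw [hsm]
        change φ.symm (toAbar k n (e k n ⊤)) • u = 0
        rw [toAbar_e_top, map_zero, zero_smul]
    let M : FCat k n := ⟨ModuleCat.of _ (HomE k n X ⧸ homInto Y), finLen_of_finite,
      isTorsionless_quotient_homInto Y⟩
    refine ⟨M, ⟨(finLen (Preproj k (n - 1))).isoMk ?_⟩⟩
    refine deltaPiIso φ M U.obj g.toAddMonoidHom hg (fun a m ↦ g.map_smul a m) fun m ↦ ?_
    change m ∈ LinearMap.ker g ↔ _
    rw [hk]

theorem isEquivalence_lift
    (hδ : ∀ (X Y : FCat k n) (f g : X ⟶ Y), idealRel (ObjectProperty.singleton (TObj k n)) f g →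
      (deltaPi φ).map f = (deltaPi φ).map g) :
    (CategoryTheory.Quotient.lift _ (deltaPi φ) hδ :
      FactorCategory (ObjectProperty.singleton (TObj k n)) ⥤
        FinMod (Preproj k (n - 1))).IsEquivalence where
  faithful := ⟨fun {X Y} f g h ↦ by
    obtain ⟨f, rfl⟩ := (Quotient.functor _).map_surjective f
    obtain ⟨g, rfl⟩ := (Quotient.functor _).map_surjective g
    exact CategoryTheory.Quotient.sound _ ((deltaPi_map_eq_iff_idealRel φ f g).1 h)⟩
  full := ⟨fun {X Y} h ↦ by
    obtain ⟨f, hf⟩ := (deltaPi φ).map_surjective (X := X.as) (Y := Y.as) h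
    exact ⟨(Quotient.functor _).map f, hf⟩⟩
  essSurj := ⟨fun U ↦ by
    obtain ⟨M, hM⟩ := Functor.EssSurj.mem_essImage (F := deltaPi φ) U
    exact ⟨⟨M⟩, hM⟩⟩

end Equivalence

/-! ### The structure of the preprojective algebra -/

section Paths

variable (k : Type u) [Field k] (m : ℕ)

/-- The vertex `i`, or zero. -/
def pv (i : ℕ) : Preproj k m := if h : i < m then Preproj.gen k m (.vert ⟨i, h⟩) else 0

/-- The arrow `i → i+1`, or zero. -/
def pu (i : ℕ) : Preproj k m := if h : i < m - 1 then Preproj.gen k m (.up ⟨i, h⟩) else 0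

/-- The arrow `i+1 → i`, or zero. -/
def pd (i : ℕ) : Preproj k m := if h : i < m - 1 then Preproj.gen k m (.down ⟨i, h⟩) else 0

/-- The sum of the 2-cycles `i → i+1 → i`. -/
def pz : Preproj k m := ∑ i ∈ Finset.range (m - 1), pu k m i * pd k m i

variable {k m}

theorem gen_vert (i : Fin m) : Preproj.gen k m (.vert i) = pv k m i := by
  rw [pv, dif_pos i.2]

theorem gen_up (i : Fin (m - 1)) : Preproj.gen k m (.up i) = pu k m i := by
  rw [pu, dif_pos i.2]

theorem gen_down (i : Fin (m - 1)) : Preproj.gen k m (.down i) = pd k m i := by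
  rw [pd, dif_pos i.2]

variable (k m) in
/-- The projection of the free algebra onto the preprojective algebra. -/
def Preproj.mk : FreeAlgebra k (PreprojGen m) →ₐ[k] Preproj k m :=
  RingQuot.mkAlgHom k (PreprojRel k m)

theorem Preproj.rel {a b : FreeAlgebra k (PreprojGen m)} (h : PreprojRel k m a b) :
    Preproj.mk k m a = Preproj.mk k m b :=
  RingQuot.mkAlgHom_rel k h

theorem pv_eq_zero {i : ℕ} (h : m ≤ i) : pv k m i = 0 := dif_neg (by omega)

theorem pv_mul_self (i : ℕ) : pv k m i * pv k m i = pv k m i := by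
  by_cases h : i < m
  · have := Preproj.rel (k := k) (.vert_idem ⟨i, h⟩)
    rw [map_mul] at this
    rw [pv, dif_pos h]
    exact this
  · rw [pv_eq_zero (by omega), mul_zero]

theorem pv_mul_pv_of_ne {i j : ℕ} (hij : i ≠ j) : pv k m i * pv k m j = 0 := by
  by_cases h : i < m
  · by_cases h' : j < m
    · have := Preproj.rel (k := k) (.vert_orth ⟨i, h⟩ ⟨j, h'⟩ (by simpa using hij))
      rw [map_mul, map_zero] at this
      rw [pv, dif_pos h, pv, dif_pos h']
      exact this
    · rw [pv_eq_zero (i := j) (by omega), mul_zero]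
  · rw [pv_eq_zero (by omega), zero_mul]

theorem sum_pv : ∑ i ∈ Finset.range m, pv k m i = 1 := by
  have := Preproj.rel (k := k) (m := m) .sum_vert
  rw [map_sum, map_one] at this
  rw [← Fin.sum_univ_eq_sum_range]
  simp only [← gen_vert]
  exact this

theorem pv_pu_pv (i : ℕ) : pv k m i * pu k m i * pv k m (i + 1) = pu k m i := by
  by_cases h : i < m - 1
  · have := Preproj.rel (k := k) (.up_path ⟨i, h⟩)
    rw [map_mul, map_mul] at this
    have h1 := gen_vert (k := k) (src ⟨i, h⟩)
    have h2 := gen_vert (k := k) (tgt ⟨i, h⟩)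
    have h3 := gen_up (k := k) (⟨i, h⟩ : Fin (m - 1))
    simp only [src, tgt] at h1 h2 h3
    rw [← h1, ← h2, ← h3]
    exact this
  · rw [pu, dif_neg h, mul_zero, zero_mul]

theorem pv_pd_pv (i : ℕ) : pv k m (i + 1) * pd k m i * pv k m i = pd k m i := by
  by_cases h : i < m - 1
  · have := Preproj.rel (k := k) (.down_path ⟨i, h⟩)
    rw [map_mul, map_mul] at this
    have h1 := gen_vert (k := k) (src ⟨i, h⟩)
    have h2 := gen_vert (k := k) (tgt ⟨i, h⟩)
    have h3 := gen_down (k := k) (⟨i, h⟩ : Fin (m - 1))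
    simp only [src, tgt] at h1 h2 h3
    rw [← h1, ← h2, ← h3]
    exact this
  · rw [pd, dif_neg h, mul_zero, zero_mul]

theorem pv_mul_pu (i : ℕ) : pv k m i * pu k m i = pu k m i := by
  rw [← pv_pu_pv, ← mul_assoc, ← mul_assoc, pv_mul_self]

theorem pu_mul_pv (i : ℕ) : pu k m i * pv k m (i + 1) = pu k m i := by
  rw [← pv_pu_pv, mul_assoc, pv_mul_self]

theorem pv_mul_pd (i : ℕ) : pv k m (i + 1) * pd k m i = pd k m i := by
  rw [← pv_pd_pv, ← mul_assoc, ← mul_assoc, pv_mul_self]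

theorem pd_mul_pv (i : ℕ) : pd k m i * pv k m i = pd k m i := by
  rw [← pv_pd_pv, mul_assoc, pv_mul_self]

theorem pv_mul_pu_of_ne {i j : ℕ} (h : j ≠ i) : pv k m j * pu k m i = 0 := by
  rw [← pv_mul_pu, ← mul_assoc, pv_mul_pv_of_ne h, zero_mul]

theorem pv_mul_pd_of_ne {i j : ℕ} (h : j ≠ i + 1) : pv k m j * pd k m i = 0 := by
  rw [← pv_mul_pd, ← mul_assoc, pv_mul_pv_of_ne h, zero_mul]

/-- This is where the preprojective relation enters. Comparing the two expressions at a vertex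
identifies its two 2-cycles, so z commutes with vertices and arrows; z vanishes at vertex 0, where
no downward arrow starts. -/
theorem pz_eq : pz k m = ∑ i ∈ Finset.range (m - 1), pd k m i * pu k m i := by
  have := Preproj.rel (k := k) (m := m) .preproj
  rw [map_sum, map_zero] at this
  simp only [map_sub, map_mul] at this
  rw [Finset.sum_sub_distrib, sub_eq_zero] at this
  rw [pz, ← Fin.sum_univ_eq_sum_range (fun i ↦ pu k m i * pd k m i),
    ← Fin.sum_univ_eq_sum_range (fun i ↦ pd k m i * pu k m i)]
  simp only [← gen_up, ← gen_down]
  exact this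

theorem pv_mul_pz (i : ℕ) : pv k m i * pz k m = pu k m i * pd k m i := by
  rw [pz, Finset.mul_sum, Finset.sum_eq_single i]
  · rw [← mul_assoc, pv_mul_pu]
  · intro j _ hj
    rw [← mul_assoc, pv_mul_pu_of_ne hj.symm, zero_mul]
  · intro h
    rw [pu, dif_neg (by simpa using h), zero_mul, mul_zero]

theorem pz_mul_pv (i : ℕ) : pz k m * pv k m i = pu k m i * pd k m i := by
  rw [pz, Finset.sum_mul, Finset.sum_eq_single i]
  · rw [mul_assoc, pd_mul_pv]
  · intro j _ hj
    rw [← pd_mul_pv, mul_assoc, mul_assoc, pv_mul_pv_of_ne hj, mul_zero, mul_zero]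
  · intro h
    rw [pu, dif_neg (by simpa using h), zero_mul, zero_mul]

theorem pv_succ_mul_pz (i : ℕ) : pv k m (i + 1) * pz k m = pd k m i * pu k m i := by
  rw [pz_eq, Finset.mul_sum, Finset.sum_eq_single i]
  · rw [← mul_assoc, pv_mul_pd]
  · intro j _ hj
    rw [← mul_assoc, pv_mul_pd_of_ne (by omega), zero_mul]
  · intro h
    rw [pu, dif_neg (by simpa using h), mul_zero, mul_zero]

theorem pv_zero_mul_pz : pv k m 0 * pz k m = 0 := by
  rw [pz_eq, Finset.mul_sum]
  refine Finset.sum_eq_zero fun i _ ↦ ?_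
  rw [← mul_assoc, pv_mul_pd_of_ne (by omega), zero_mul]

theorem commute_pz_pv (i : ℕ) : Commute (pz k m) (pv k m i) :=
  (pz_mul_pv i).trans (pv_mul_pz i).symm

theorem commute_pz_pu (i : ℕ) : Commute (pz k m) (pu k m i) := by
  change pz k m * pu k m i = pu k m i * pz k m
  conv_lhs => rw [← pv_mul_pu, ← mul_assoc, pz_mul_pv]
  conv_rhs => rw [← pu_mul_pv, mul_assoc, pv_succ_mul_pz]
  rw [mul_assoc]

theorem commute_pz_pd (i : ℕ) : Commute (pz k m) (pd k m i) := by
  change pz k m * pd k m i = pd k m i * pz k m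
  conv_lhs => rw [← pv_mul_pd, ← mul_assoc, (commute_pz_pv _).eq, pv_succ_mul_pz]
  conv_rhs => rw [← pd_mul_pv, mul_assoc, pv_mul_pz]
  rw [mul_assoc]

/-- At vertex i+1 one factor z is the detour through vertex i. The remaining powers of z commute
past the arrow and act at vertex i, so induction ends at vertex 0. `pz_pow_mul_pv_of_le` is the same
descent towards the other end. -/
theorem pz_pow_mul_pv (i : ℕ) : pz k m ^ (i + 1) * pv k m i = 0 := by
  induction i with
  | zero => rw [pow_one, (commute_pz_pv _).eq, pv_zero_mul_pz]
  | succ i ih =>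
    rw [pow_succ, mul_assoc, (commute_pz_pv _).eq, pv_succ_mul_pz, ← pd_mul_pv, mul_assoc,
      ← mul_assoc, ((commute_pz_pd i).pow_left _).eq, mul_assoc, ← mul_assoc _ (pv k m i), ih,
      zero_mul, mul_zero]

theorem pz_pow_mul_pv_of_le {i d : ℕ} (h : m ≤ i + d) : pz k m ^ d * pv k m i = 0 := by
  induction d generalizing i with
  | zero => rw [pv_eq_zero (by omega), mul_zero]
  | succ d ih =>
    rw [pow_succ, mul_assoc, pz_mul_pv, ← pu_mul_pv, mul_assoc,
      ← mul_assoc, ((commute_pz_pu i).pow_left _).eq, mul_assoc, ← mul_assoc _ (pv k m (i + 1)),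
      ih (by omega), zero_mul, mul_zero]

/-! ### Shortest paths and normal forms in the preprojective algebra -/

variable (k m) in
/-- The shortest path from `i` to `i + d`. -/
def pup : ℕ → ℕ → Preproj k m
  | i, 0 => pv k m i
  | i, d + 1 => pu k m i * pup (i + 1) d

variable (k m) in
/-- The shortest path from `j + d` to `j`. -/
def pdn (j : ℕ) : ℕ → Preproj k m
  | 0 => pv k m j
  | d + 1 => pd k m (j + d) * pdn j d

variable (k m) in
/-- The shortest path from `i` to `j`. -/
def pp (i j : ℕ) : Preproj k m := if i ≤ j then pup k m i (j - i) else pdn k m j (i - j)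

theorem pup_eq_pp (i d : ℕ) : pup k m i d = pp k m i (i + d) := by
  rw [pp, if_pos (Nat.le_add_right _ _), Nat.add_sub_cancel_left]

theorem pdn_eq_pp (j d : ℕ) : pdn k m j d = pp k m (j + d) j := by
  rcases d with _ | d
  · exact pup_eq_pp j 0
  · rw [pp, if_neg (by omega), Nat.add_sub_cancel_left]

theorem pp_self (i : ℕ) : pp k m i i = pv k m i := (pup_eq_pp i 0).symm

theorem pu_mul_pp_of_lt {l j : ℕ} (h : l < j) : pu k m l * pp k m (l + 1) j = pp k m l j := by
  obtain ⟨d, rfl⟩ := Nat.exists_eq_add_of_le (show l + 1 ≤ j from h)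
  rw [← pup_eq_pp, show l + 1 + d = l + (d + 1) by omega, ← pup_eq_pp, pup]

theorem pd_mul_pp_of_le {l j : ℕ} (h : j ≤ l) : pd k m l * pp k m l j = pp k m (l + 1) j := by
  obtain ⟨d, rfl⟩ := Nat.exists_eq_add_of_le h
  rw [← pdn_eq_pp, add_assoc, ← pdn_eq_pp, pdn]

theorem pv_mul_pp (i j : ℕ) : pv k m i * pp k m i j = pp k m i j := by
  rcases lt_trichotomy i j with h | rfl | h
  · rw [← pu_mul_pp_of_lt h, ← mul_assoc, pv_mul_pu]
  · rw [pp_self, pv_mul_self]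
  · obtain ⟨i, rfl⟩ : ∃ l, i = l + 1 := ⟨i - 1, by omega⟩
    rw [← pd_mul_pp_of_le (by omega), ← mul_assoc, pv_mul_pd]

/-- A step away from the target is undone by the first step of the shortest path back, and the
resulting 2-cycle is a factor z. -/
theorem pu_mul_pp_of_le {l j : ℕ} (h : j ≤ l) :
    pu k m l * pp k m (l + 1) j = pz k m * pp k m l j := by
  rw [← pd_mul_pp_of_le h, ← mul_assoc, ← pz_mul_pv, mul_assoc, pv_mul_pp]

theorem pd_mul_pp_of_lt {l j : ℕ} (h : l < j) :
    pd k m l * pp k m l j = pz k m * pp k m (l + 1) j := by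
  rw [← pu_mul_pp_of_lt h, ← mul_assoc, ← pv_succ_mul_pz, ← (commute_pz_pv _).eq, mul_assoc,
    pv_mul_pp]

theorem pup_mul_pv (i d : ℕ) : pup k m i d * pv k m (i + d) = pup k m i d := by
  induction d generalizing i with
  | zero => exact pv_mul_self i
  | succ d ih => rw [pup, mul_assoc, show i + (d + 1) = i + 1 + d by omega, ih]

theorem pdn_mul_pv (j d : ℕ) : pdn k m j d * pv k m j = pdn k m j d := by
  induction d with
  | zero => exact pv_mul_self j
  | succ d ih => rw [pdn, mul_assoc, ih]

theorem pp_mul_pv (i j : ℕ) : pp k m i j * pv k m j = pp k m i j := by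
  rcases le_total i j with h | h
  · obtain ⟨d, rfl⟩ := Nat.exists_eq_add_of_le h
    rw [← pup_eq_pp, pup_mul_pv]
  · obtain ⟨d, rfl⟩ := Nat.exists_eq_add_of_le h
    rw [← pdn_eq_pp, pdn_mul_pv]

theorem commute_pz_pp (i j : ℕ) : Commute (pz k m) (pp k m i j) := by
  rcases le_total i j with h | h
  · obtain ⟨d, rfl⟩ := Nat.exists_eq_add_of_le h
    rw [← pup_eq_pp]
    clear h
    induction d generalizing i with
    | zero => exact commute_pz_pv i
    | succ d ih => exact (commute_pz_pu i).mul_right (ih _)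
  · obtain ⟨d, rfl⟩ := Nat.exists_eq_add_of_le h
    rw [← pdn_eq_pp]
    clear h
    induction d with
    | zero => exact commute_pz_pv j
    | succ d ih => exact (commute_pz_pd _).mul_right ih

/-- Powers of z commute with the path, so z^s may be moved to whichever endpoint it kills. -/
theorem pz_pow_mul_pp {i j s : ℕ} (h : i < s ∨ j < s ∨ m ≤ i + s ∨ m ≤ j + s) :
    pz k m ^ s * pp k m i j = 0 := by
  have hv : ∀ l, l < s ∨ m ≤ l + s → pz k m ^ s * pv k m l = 0 := by
    rintro l (h | h)
    · rw [← Nat.sub_add_cancel (show l + 1 ≤ s from h), pow_add, mul_assoc, pz_pow_mul_pv, mul_zero]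
    · exact pz_pow_mul_pv_of_le h
  have h' : (i < s ∨ m ≤ i + s) ∨ (j < s ∨ m ≤ j + s) := by tauto
  rcases h' with h | h
  · rw [← pv_mul_pp, ← mul_assoc, hv i h, zero_mul]
  · rw [← pp_mul_pv, ← mul_assoc, ((commute_pz_pp i j).pow_left s).eq, mul_assoc, hv j h, mul_zero]

theorem commute_aeval {R : Type*} [Ring R] [Algebra k R] {x y : R} (h : Commute x y)
    (q : Polynomial k) : Commute (Polynomial.aeval x q) y := by
  induction q using Polynomial.induction_on' with
  | add p q hp hq => rw [map_add]; exact hp.add_left hq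
  | monomial s c =>
    rw [Polynomial.aeval_monomial]
    exact (Algebra.commute_algebraMap_left c y).mul_left (h.pow_left s)

/-- Every path from `i` to `j` is a polynomial in the 2-cycles times the shortest path. -/
theorem exists_pv_mul_mul_pv (w : Preproj k m) (i j : ℕ) :
    ∃ q : Polynomial k, pv k m i * w * pv k m j = Polynomial.aeval (pz k m) q * pp k m i j := by
  -- All corners are treated together: S contains 1 and is stable under left multiplication by the
  -- generators, hence is everything.
  let S : Submodule k (Preproj k m) :=
    { carrier := {w | ∀ i j, ∃ q : Polynomial k,
        pv k m i * w * pv k m j = Polynomial.aeval (pz k m) q * pp k m i j}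
      add_mem' := fun {a b} ha hb i j ↦ by
        obtain ⟨p, hp⟩ := ha i j
        obtain ⟨q, hq⟩ := hb i j
        exact ⟨p + q, by rw [map_add, add_mul, mul_add, add_mul, hp, hq]⟩
      zero_mem' := fun i j ↦ ⟨0, by rw [map_zero, mul_zero, zero_mul, zero_mul]⟩
      smul_mem' := fun c a ha i j ↦ by
        obtain ⟨p, hp⟩ := ha i j
        exact ⟨c • p, by rw [map_smul, smul_mul_assoc, mul_smul_comm, smul_mul_assoc, hp]⟩ }
  have hS : ∀ w, w ∈ S ↔ ∀ i j, ∃ q : Polynomial k,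
      pv k m i * w * pv k m j = Polynomial.aeval (pz k m) q * pp k m i j := fun _ ↦ Iff.rfl
  have h1 : (1 : Preproj k m) ∈ S := by
    rw [hS]
    intro i j
    rw [mul_one]
    by_cases h : i = j
    · subst h
      exact ⟨1, by rw [map_one, one_mul, pp_self, pv_mul_self]⟩
    · exact ⟨0, by rw [map_zero, zero_mul, pv_mul_pv_of_ne h]⟩
  have key : ∀ (b : FreeAlgebra k (PreprojGen m)), ∀ w ∈ S,
      Preproj.mk k m b * w ∈ S := by
    intro b
    induction b using FreeAlgebra.induction with
    | grade0 c =>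
      intro w hw
      rw [AlgHom.commutes, ← Algebra.smul_def]
      exact S.smul_mem c hw
    | mul a b ha hb =>
      intro w hw
      rw [map_mul, mul_assoc]
      exact ha _ (hb _ hw)
    | add a b ha hb =>
      intro w hw
      rw [map_add, add_mul]
      exact S.add_mem (ha _ hw) (hb _ hw)
    | grade1 g =>
      intro w hw
      change Preproj.gen k m g * w ∈ S
      rw [hS]
      intro i j
      cases g with
      | vert l =>
        rw [gen_vert, ← mul_assoc]
        by_cases h : i = l
        · subst h
          rw [pv_mul_self]
          exact hw _ _
        · exact ⟨0, by rw [pv_mul_pv_of_ne h, map_zero, zero_mul, zero_mul, zero_mul]⟩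
      | up l =>
        rw [gen_up, ← mul_assoc]
        by_cases h : i = l
        · subst h
          obtain ⟨q, hq⟩ := hw (l + 1) j
          rw [pv_mul_pu, ← pu_mul_pv, mul_assoc, mul_assoc, ← mul_assoc (pv k m _), hq, ← mul_assoc,
            ← (commute_aeval (commute_pz_pu _) q).eq, mul_assoc]
          rcases lt_or_ge (l : ℕ) j with h | h
          · exact ⟨q, by rw [pu_mul_pp_of_lt h]⟩
          · exact ⟨q * Polynomial.X, by
              rw [pu_mul_pp_of_le h, map_mul, Polynomial.aeval_X, mul_assoc]⟩
        · exact ⟨0, by rw [pv_mul_pu_of_ne h, map_zero, zero_mul, zero_mul, zero_mul]⟩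
      | down l =>
        rw [gen_down, ← mul_assoc]
        by_cases h : i = l + 1
        · subst h
          obtain ⟨q, hq⟩ := hw l j
          rw [pv_mul_pd, ← pd_mul_pv, mul_assoc, mul_assoc, ← mul_assoc (pv k m _), hq, ← mul_assoc,
            ← (commute_aeval (commute_pz_pd _) q).eq, mul_assoc]
          rcases lt_or_ge (l : ℕ) j with h | h
          · exact ⟨q * Polynomial.X, by
              rw [pd_mul_pp_of_lt h, map_mul, Polynomial.aeval_X, mul_assoc]⟩
          · exact ⟨q, by rw [pd_mul_pp_of_le h]⟩
        · exact ⟨0, by rw [pv_mul_pd_of_ne h, map_zero, zero_mul, zero_mul, zero_mul]⟩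
  obtain ⟨b, rfl⟩ := RingQuot.mkAlgHom_surjective k (PreprojRel k m) w
  have := key b 1 h1
  rw [mul_one] at this
  exact this i j

theorem eq_zero_of_pv_mul_mul_pv {w : Preproj k m}
    (h : ∀ i < m, ∀ j < m, pv k m i * w * pv k m j = 0) : w = 0 := by
  rw [← one_mul w, ← mul_one (1 * w), ← sum_pv, Finset.sum_mul, Finset.sum_mul]
  refine Finset.sum_eq_zero fun i hi ↦ ?_
  rw [Finset.mul_sum]
  exact Finset.sum_eq_zero fun j hj ↦ h i (Finset.mem_range.1 hi) j (Finset.mem_range.1 hj)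

end Paths

/-! ### The preprojective algebra as a factor algebra of the Auslander algebra -/

section Iso

variable {k : Type u} [Field k] {n : ℕ}

/-- The exponent is the excess of the detour through [j] over the direct map. It vanishes when j
lies between i and l, and is 1 for the passage to a neighbour and back. -/
theorem can_comp_can (i j l : ℕ) :
    can k n j l ∘ₗ can k n i j = xbar k n ^ ((j - i) + (l - j) - (l - i)) • can k n i l := by
  refine Ind.hom_ext ?_
  rw [LinearMap.comp_apply, can_one, map_smul, can_one, LinearMap.smul_apply, can_one, smul_smul,
    smul_smul, ← pow_add, ← pow_add, Nat.sub_add_cancel (by omega)]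

theorem can_self (i : ℕ) : can k n i i = LinearMap.id :=
  Ind.hom_ext (by rw [can_one, Nat.sub_self, pow_zero, one_smul]; rfl)

/-- The endomorphism `E → [i+1] → [j+1] → E`, as an element of `A_n`. -/
def mu (i j : Fin n) (h : Ind k n (i + 1) →ₗ[Lam k n] Ind k n (j + 1)) : A k n :=
  A.of (LinearMap.single (Lam k n) (fun l : Fin n ↦ Ind k n (l + 1)) j ∘ₗ h ∘ₗ LinearMap.proj i)

theorem mu_toEnd (i j : Fin n) (h : Ind k n (i + 1) →ₗ[Lam k n] Ind k n (j + 1)) (y : E k n) :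
    (mu i j h).toEnd y = (Pi.single j (h (y i)) : E k n) := rfl

theorem arrow_eq_mu (i j : Fin n) : arrow k n i j = mu i j (can k n _ _) := rfl

theorem e_eq_mu (i : Fin n) : e k n i = mu i i LinearMap.id := rfl

theorem mu_mul_mu (i j l : Fin n) (g : Ind k n (i + 1) →ₗ[Lam k n] Ind k n (j + 1))
    (h : Ind k n (j + 1) →ₗ[Lam k n] Ind k n (l + 1)) : mu i j g * mu j l h = mu i l (h ∘ₗ g) := by
  apply A.toEnd_injective
  refine LinearMap.ext fun y ↦ ?_
  rw [A.toEnd_mul, LinearMap.comp_apply, mu_toEnd, mu_toEnd, mu_toEnd, Pi.single_eq_same]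
  rfl

theorem mu_mul_mu_of_ne {i j j' l : Fin n} (hj : j ≠ j')
    (g : Ind k n (i + 1) →ₗ[Lam k n] Ind k n (j + 1))
    (h : Ind k n (j' + 1) →ₗ[Lam k n] Ind k n (l + 1)) : mu i j g * mu j' l h = 0 := by
  apply A.toEnd_injective
  refine LinearMap.ext fun y ↦ ?_
  rw [A.toEnd_mul, LinearMap.comp_apply, mu_toEnd, mu_toEnd, Pi.single_eq_of_ne hj.symm, map_zero,
    Pi.single_zero]
  rfl

theorem mu_add (i j : Fin n) (g h : Ind k n (i + 1) →ₗ[Lam k n] Ind k n (j + 1)) :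
    mu i j (g + h) = mu i j g + mu i j h := by
  apply A.toEnd_injective
  refine LinearMap.ext fun y ↦ ?_
  rw [A.toEnd_add, LinearMap.add_apply, mu_toEnd, mu_toEnd, mu_toEnd, ← Pi.single_add]
  rfl

theorem mu_zero (i j : Fin n) :
    mu i j (0 : Ind k n (i + 1) →ₗ[Lam k n] Ind k n (j + 1)) = 0 := by
  have := mu_add i j (0 : Ind k n (i + 1) →ₗ[Lam k n] Ind k n (j + 1)) 0
  rwa [add_zero, left_eq_add] at this

theorem algebraMap_mul_mu (c : k) (i j : Fin n)
    (h : Ind k n (i + 1) →ₗ[Lam k n] Ind k n (j + 1)) :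
    algebraMap k (A k n) c * mu i j h = mu i j (algebraMap k (Lam k n) c • h) := by
  apply A.toEnd_injective
  refine LinearMap.ext fun y ↦ ?_
  rw [A.toEnd_mul, LinearMap.comp_apply, mu_toEnd, mu_toEnd, A.toEnd_algebraMap, Pi.smul_apply,
    map_smul]
  rfl

theorem A.toEnd_sum {ι : Type*} (s : Finset ι) (f : ι → A k n) (y : E k n) :
    (∑ i ∈ s, f i).toEnd y = ∑ i ∈ s, (f i).toEnd y :=
  map_sum (⟨⟨fun a : A k n ↦ a.toEnd y, rfl⟩, fun _ _ ↦ rfl⟩ : A k n →+ E k n) _ _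

theorem sum_e : ∑ i : Fin n, e k n i = 1 := by
  apply A.toEnd_injective
  refine LinearMap.ext fun y ↦ ?_
  rw [A.toEnd_sum]
  exact Finset.univ_sum_single y

theorem e_mul_mul_e (a : A k n) (i j : Fin n) :
    e k n i * a * e k n j = mu i j (LinearMap.proj j ∘ₗ a.toEnd ∘ₗ
      LinearMap.single (Lam k n) (fun l : Fin n ↦ Ind k n (l + 1)) i) := rfl

/-- The image of the generator is killed by x^i, so it is a multiple of x^(j-i), which is the image
under the canonical map. -/
theorem exists_eq_smul_can {i j : ℕ} (hj : j ≤ n) (h : Ind k n i →ₗ[Lam k n] Ind k n j) :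
    ∃ q : Polynomial k, h = toLam k n q • can k n i j := by
  obtain ⟨w, hw⟩ := Ind.exists_eq_pow_smul (i := i) hj (h 1)
    (by rw [← map_smul, Ind.pow_smul le_rfl, map_zero])
  obtain ⟨q, rfl⟩ := Ind.exists_smul w
  exact ⟨q, Ind.hom_ext (by rw [hw, LinearMap.smul_apply, can_one, smul_comm])⟩

variable [NeZero n]

theorem toAbar_algebraMap (c : k) : toAbar k n (algebraMap k (A k n) c) =
    algebraMap k (Abar k n) c := rfl

theorem toAbar_surjective : Function.Surjective (toAbar k n) := Ideal.Quotient.mk_surjective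

theorem toAbar_eq_zero_iff (a : A k n) : toAbar k n a = 0 ↔ a ∈ idealTop k n :=
  Ideal.Quotient.eq_zero_iff_mem

theorem eq_top_of_add_one_eq {i : Fin n} (h : (i : ℕ) + 1 = n) : i = ⊤ :=
  Fin.ext (by have := top_add_one (n := n); omega)

theorem toAbar_mu_of_right_eq {i j : Fin n} (hj : (j : ℕ) + 1 = n)
    (h : Ind k n (i + 1) →ₗ[Lam k n] Ind k n (j + 1)) : toAbar k n (mu i j h) = 0 := by
  have h1 : mu i j h = mu i j h * e k n j := by rw [e_eq_mu, mu_mul_mu, LinearMap.id_comp]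
  have h2 : toAbar k n (e k n j) = 0 := by rw [eq_top_of_add_one_eq hj, toAbar_e_top]
  rw [h1, map_mul, h2, mul_zero]

theorem toAbar_mu_of_left_eq {i j : Fin n} (hi : (i : ℕ) + 1 = n)
    (h : Ind k n (i + 1) →ₗ[Lam k n] Ind k n (j + 1)) : toAbar k n (mu i j h) = 0 := by
  have h1 : mu i j h = e k n i * mu i j h := by rw [e_eq_mu, mu_mul_mu, LinearMap.comp_id]
  have h2 : toAbar k n (e k n i) = 0 := by rw [eq_top_of_add_one_eq hi, toAbar_e_top]
  rw [h1, map_mul, h2, zero_mul]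

/-- The elements of `⟨e(n)⟩` map elements killed by `x^t` to multiples of `x^(n-t)`. -/
theorem exists_toEnd_eq_of_mem_idealTop {a : A k n} (ha : a ∈ idealTop k n) {t : ℕ} (y : E k n)
    (hy : xbar k n ^ t • y = 0) : ∃ z, a.toEnd y = xbar k n ^ (n - t) • z := by
  let J : Ideal (A k n) :=
    { carrier := {a | ∀ (t : ℕ) (y : E k n), xbar k n ^ t • y = 0 →
        ∃ z, a.toEnd y = xbar k n ^ (n - t) • z}
      add_mem' := fun {a b} ha hb t y hy ↦ by
        obtain ⟨z, hz⟩ := ha t y hy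
        obtain ⟨w, hw⟩ := hb t y hy
        exact ⟨z + w, by rw [A.toEnd_add, LinearMap.add_apply, hz, hw, smul_add]⟩
      zero_mem' := fun t y _ ↦ ⟨0, by rw [smul_zero]; rfl⟩
      smul_mem' := fun c a ha t y hy ↦ by
        obtain ⟨z, hz⟩ := ha t (c.toEnd y) (by rw [← map_smul, hy, map_zero])
        exact ⟨z, by rw [smul_eq_mul, A.toEnd_mul, LinearMap.comp_apply, hz]⟩ }
  have : J.IsTwoSided := ⟨fun {a} b ha t y hy ↦ by
    obtain ⟨z, hz⟩ := ha t y hy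
    exact ⟨b.toEnd z, by rw [A.toEnd_mul, LinearMap.comp_apply, hz, map_smul]⟩⟩
  have key : TwoSidedIdeal.span {e k n ⊤} ≤ J.toTwoSided := by
    rw [TwoSidedIdeal.span_le, Set.singleton_subset_iff]
    change e k n ⊤ ∈ J.toTwoSided
    rw [Ideal.mem_toTwoSided]
    intro t y hy
    -- The endomorphism e(n) passes through [n], where an element killed by x^t is a multiple of
    -- x^(n-t).
    obtain ⟨w, hw⟩ := Ind.exists_eq_pow_smul (i := t) le_rfl (topPr k n y)
      (by rw [← map_smul, hy, map_zero])
    exact ⟨topIn k n w, by rw [toEnd_e_top, LinearMap.comp_apply, hw, map_smul]⟩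
  have h1 : a ∈ J.toTwoSided := key ha
  rw [Ideal.mem_toTwoSided] at h1
  exact h1 t y hy

/-! ### The homomorphism from the preprojective algebra and its bijectivity -/

variable (k n) in
/-- The images of the generators of the preprojective algebra. -/
def genImage : PreprojGen (n - 1) → Abar k n
  | .vert i => toAbar k n (e k n (vtx i))
  | .up i => toAbar k n (arrow k n (vtx (src i)) (vtx (tgt i)))
  | .down i => toAbar k n (arrow k n (vtx (tgt i)) (vtx (src i)))

variable (k n) in
/-- The class of multiplication by `x` on `[i+1]`. -/
def loopX (i : ℕ) : Abar k n :=
  if h : i < n then toAbar k n (mu ⟨i, h⟩ ⟨i, h⟩ (xbar k n • LinearMap.id)) else 0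

theorem toAbar_arrow_mul_arrow_of_lt {i j : Fin n} (h : (i : ℕ) + 1 = j) :
    toAbar k n (arrow k n i j) * toAbar k n (arrow k n j i) = loopX k n i := by
  rw [← map_mul, arrow_eq_mu, arrow_eq_mu, mu_mul_mu, can_comp_can, can_self, loopX, dif_pos i.2]
  congr 4
  rw [show (j : ℕ) + 1 - (i + 1) + (i + 1 - (j + 1)) - (i + 1 - (i + 1)) = 1 by omega, pow_one]

theorem toAbar_arrow_mul_arrow_of_gt {i j : Fin n} (h : (i : ℕ) + 1 = j) :
    toAbar k n (arrow k n j i) * toAbar k n (arrow k n i j) = loopX k n (i + 1) := by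
  have hi : (i : ℕ) + 1 < n := h ▸ j.2
  obtain rfl : j = ⟨i + 1, hi⟩ := Fin.ext h.symm
  rw [← map_mul, arrow_eq_mu, arrow_eq_mu, mu_mul_mu, can_comp_can, can_self, loopX,
    dif_pos (by omega)]
  congr 4
  simp only
  rw [show (i : ℕ) + 1 - (i + 1 + 1) + (i + 1 + 1 - (i + 1)) - (i + 1 + 1 - (i + 1 + 1)) = 1 by
    omega, pow_one]

theorem loopX_zero : loopX k n 0 = 0 := by
  have hn : 0 < n := Nat.pos_of_ne_zero (NeZero.ne n)
  rw [loopX, dif_pos hn]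
  have : (xbar k n • LinearMap.id : Ind k n ((⟨0, hn⟩ : Fin n) + 1) →ₗ[Lam k n] _) = 0 := by
    refine LinearMap.ext fun z ↦ ?_
    exact (congrArg (fun a : Lam k n ↦ a • z) (pow_one (xbar k n)).symm).trans
      (Ind.pow_smul (j := 1) le_rfl z)
  rw [this, mu_zero, map_zero]

/-- For i = n-2, multiplication by x on [n-1] is the composite [n-1] → [n] → [n-1], which lies in
⟨e(n)⟩. For i = n-1 the summand is [n] itself, and beyond that the value is 0 by definition. -/
theorem loopX_of_eq {i : ℕ} (h : n ≤ i + 2) : loopX k n i = 0 := by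
  rcases Nat.lt_or_ge (i + 1) n with h1 | h1
  · rw [← toAbar_arrow_mul_arrow_of_lt (i := ⟨i, by omega⟩) (j := ⟨i + 1, h1⟩) rfl, arrow_eq_mu,
      toAbar_mu_of_right_eq (by simp only; omega), zero_mul]
  · rw [loopX]
    split_ifs with h2
    · exact toAbar_mu_of_right_eq (by simp only; omega) _
    · rfl

theorem sum_toAbar_e : ∑ i : Fin (n - 1), toAbar k n (e k n (vtx i)) = 1 := by
  obtain ⟨m, rfl⟩ := Nat.exists_eq_succ_of_ne_zero (NeZero.ne n)
  rw [← map_one (toAbar k (m + 1)), ← sum_e, map_sum, Fin.sum_univ_castSucc]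
  have h1 : toAbar k (m + 1) (e k (m + 1) (Fin.last m)) = 0 := toAbar_e_top
  rw [h1, add_zero]
  rfl

theorem genImage_rel {a b : FreeAlgebra k (PreprojGen (n - 1))} (h : PreprojRel k (n - 1) a b) :
    FreeAlgebra.lift k (genImage k n) a = FreeAlgebra.lift k (genImage k n) b := by
  cases h with
  | vert_idem i =>
    simp only [map_mul, FreeAlgebra.lift_ι_apply, genImage]
    rw [← map_mul, e_eq_mu, mu_mul_mu, LinearMap.comp_id]
  | vert_orth i j h =>
    simp only [map_mul, FreeAlgebra.lift_ι_apply, genImage, map_zero]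
    rw [← map_mul, e_eq_mu, e_eq_mu, mu_mul_mu_of_ne, map_zero]
    exact fun h' ↦ h (by simpa [vtx] using h')
  | sum_vert =>
    simp only [map_sum, FreeAlgebra.lift_ι_apply, genImage, map_one]
    exact sum_toAbar_e
  | up_path i =>
    simp only [map_mul, FreeAlgebra.lift_ι_apply, genImage]
    rw [← map_mul, ← map_mul, e_eq_mu, e_eq_mu, arrow_eq_mu, mu_mul_mu, mu_mul_mu,
      LinearMap.comp_id, LinearMap.id_comp]
  | down_path i =>
    simp only [map_mul, FreeAlgebra.lift_ι_apply, genImage]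
    rw [← map_mul, ← map_mul, e_eq_mu, e_eq_mu, arrow_eq_mu, mu_mul_mu, mu_mul_mu,
      LinearMap.comp_id, LinearMap.id_comp]
  | preproj =>
    simp only [map_sum, map_sub, map_mul, FreeAlgebra.lift_ι_apply, genImage, map_zero]
    have : ∀ i : Fin (n - 1 - 1),
        toAbar k n (arrow k n (vtx (src i)) (vtx (tgt i))) *
            toAbar k n (arrow k n (vtx (tgt i)) (vtx (src i))) -
          toAbar k n (arrow k n (vtx (tgt i)) (vtx (src i))) *
            toAbar k n (arrow k n (vtx (src i)) (vtx (tgt i))) =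
        loopX k n i - loopX k n (i + 1) := fun i ↦ by
      rw [toAbar_arrow_mul_arrow_of_lt rfl, toAbar_arrow_mul_arrow_of_gt rfl]
      rfl
    simp only [this]
    -- The sum telescopes to multiplication by x on [1] minus that on [n-1], and both classes
    -- vanish.
    rw [Fin.sum_univ_eq_sum_range (fun i ↦ loopX k n i - loopX k n (i + 1)),
      Finset.sum_range_sub', loopX_zero, loopX_of_eq (by omega), sub_zero]

variable (k n) in
/-- The canonical homomorphism `Π_{n-1} → A_n/⟨e(n)⟩`. -/
def toFactor : Preproj k (n - 1) →ₐ[k] Abar k n :=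
  RingQuot.liftAlgHom k ⟨FreeAlgebra.lift k (genImage k n), fun _ _ h ↦ genImage_rel h⟩

theorem toFactor_gen (g : PreprojGen (n - 1)) :
    toFactor k n (Preproj.gen k (n - 1) g) = genImage k n g :=
  (RingQuot.liftAlgHom_mkAlgHom_apply k _ _ _).trans (FreeAlgebra.lift_ι_apply _ _)

theorem toFactor_pv {i : ℕ} (h : i + 1 < n) :
    toFactor k n (pv k (n - 1) i) = toAbar k n (e k n ⟨i, by omega⟩) := by
  rw [pv, dif_pos (by omega), toFactor_gen]
  rfl

theorem toFactor_pu {i : ℕ} (h : i + 2 < n) : toFactor k n (pu k (n - 1) i) =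
    toAbar k n (arrow k n ⟨i, by omega⟩ ⟨i + 1, by omega⟩) := by
  rw [pu, dif_pos (by omega), toFactor_gen]
  rfl

theorem toFactor_pd {i : ℕ} (h : i + 2 < n) : toFactor k n (pd k (n - 1) i) =
    toAbar k n (arrow k n ⟨i + 1, by omega⟩ ⟨i, by omega⟩) := by
  rw [pd, dif_pos (by omega), toFactor_gen]
  rfl

omit [NeZero n] in
theorem arrow_mul_arrow {i j l : Fin n} (h : (i ≤ j ∧ j ≤ l) ∨ (l ≤ j ∧ j ≤ i)) :
    arrow k n i j * arrow k n j l = arrow k n i l := by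
  rw [arrow_eq_mu, arrow_eq_mu, mu_mul_mu, can_comp_can, arrow_eq_mu]
  have h' : ((i : ℕ) ≤ j ∧ (j : ℕ) ≤ l) ∨ ((l : ℕ) ≤ j ∧ (j : ℕ) ≤ i) := h
  rw [show (j : ℕ) + 1 - (i + 1) + (l + 1 - (j + 1)) - (l + 1 - (i + 1)) = 0 by omega, pow_zero,
    one_smul]

theorem toFactor_pup (i d : ℕ) (h : i + d + 1 < n) : toFactor k n (pup k (n - 1) i d) =
    toAbar k n (arrow k n ⟨i, by omega⟩ ⟨i + d, by omega⟩) := by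
  induction d generalizing i with
  | zero =>
    rw [pup, toFactor_pv h, e_eq_mu, arrow_eq_mu, ← can_self]
    rfl
  | succ d ih =>
    have h1 : (⟨i + (d + 1), by omega⟩ : Fin n) = ⟨i + 1 + d, by omega⟩ :=
      Fin.ext (by simp only; omega)
    rw [pup, map_mul, toFactor_pu (by omega), ih (i + 1) (by omega), ← map_mul, arrow_mul_arrow,
      h1]
    left
    constructor <;> rw [Fin.mk_le_mk] <;> omega

theorem toFactor_pdn (j d : ℕ) (h : j + d + 1 < n) : toFactor k n (pdn k (n - 1) j d) =
    toAbar k n (arrow k n ⟨j + d, by omega⟩ ⟨j, by omega⟩) := by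
  induction d with
  | zero => exact toFactor_pup j 0 h
  | succ d ih =>
    rw [pdn, map_mul, toFactor_pd (by omega), ih (by omega), ← map_mul, arrow_mul_arrow]
    · rfl
    right
    constructor <;> rw [Fin.mk_le_mk] <;> omega

theorem toFactor_pp {i j : ℕ} (hi : i + 1 < n) (hj : j + 1 < n) :
    toFactor k n (pp k (n - 1) i j) =
      toAbar k n (arrow k n ⟨i, by omega⟩ ⟨j, by omega⟩) := by
  rcases le_total i j with h | h
  · obtain ⟨d, rfl⟩ := Nat.exists_eq_add_of_le h
    rw [← pup_eq_pp, toFactor_pup i d hj]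
  · obtain ⟨d, rfl⟩ := Nat.exists_eq_add_of_le h
    rw [← pdn_eq_pp, toFactor_pdn j d hi]

/-- At each vertex z becomes the 2-cycle [i+1] → [i+2] → [i+1], which is multiplication by x. -/
theorem toFactor_pz_mul {i j : Fin n} (hi : (i : ℕ) + 1 < n)
    (h : Ind k n (i + 1) →ₗ[Lam k n] Ind k n (j + 1)) :
    toFactor k n (pz k (n - 1)) * toAbar k n (mu i j h) = toAbar k n (mu i j (xbar k n • h)) := by
  have h1 : mu i j h = e k n i * mu i j h := by rw [e_eq_mu, mu_mul_mu, LinearMap.comp_id]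
  have h2 : toFactor k n (pz k (n - 1)) * toAbar k n (e k n i) = loopX k n i := by
    rw [← toFactor_pv hi, ← map_mul, pz_mul_pv]
    by_cases h : (i : ℕ) + 2 < n
    · rw [map_mul, toFactor_pu h, toFactor_pd h, toAbar_arrow_mul_arrow_of_lt rfl]
    · rw [pu, dif_neg (by omega), zero_mul, map_zero, loopX_of_eq (by omega)]
  rw [h1, map_mul, ← mul_assoc, h2, loopX, dif_pos i.2, ← map_mul, mu_mul_mu]
  congr 2
  refine LinearMap.ext fun z ↦ ?_
  simp

theorem toFactor_aeval_mul (q : Polynomial k) {i j : Fin n} (hi : (i : ℕ) + 1 < n)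
    (h : Ind k n (i + 1) →ₗ[Lam k n] Ind k n (j + 1)) :
    toFactor k n (Polynomial.aeval (pz k (n - 1)) q) * toAbar k n (mu i j h) =
      toAbar k n (mu i j (toLam k n q • h)) := by
  induction q using Polynomial.induction_on' with
  | add p q hp hq => rw [map_add, map_add, add_mul, hp, hq, map_add, add_smul, mu_add, map_add]
  | monomial s c =>
    have hs : toFactor k n (pz k (n - 1)) ^ s * toAbar k n (mu i j h) =
        toAbar k n (mu i j (xbar k n ^ s • h)) := by
      induction s with
      | zero => rw [pow_zero, pow_zero, one_mul, one_smul]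
      | succ s ih =>
        have hx : xbar k n ^ (s + 1) • h = xbar k n • xbar k n ^ s • h := by
          rw [smul_smul, ← pow_succ']
        rw [hx, pow_succ', mul_assoc, ih, toFactor_pz_mul hi]
    rw [Polynomial.aeval_monomial, map_mul, map_pow, mul_assoc, hs, AlgHom.commutes,
      ← toAbar_algebraMap, ← map_mul, algebraMap_mul_mu, smul_smul,
      ← Polynomial.C_mul_X_pow_eq_monomial, map_mul, map_pow, toLam_X, toLam_C]

theorem toFactor_aeval_mul_pp (q : Polynomial k) {i j : ℕ} (hi : i + 1 < n) (hj : j + 1 < n) :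
    toFactor k n (Polynomial.aeval (pz k (n - 1)) q * pp k (n - 1) i j) =
      toAbar k n (mu ⟨i, by omega⟩ ⟨j, by omega⟩ (toLam k n q • can k n (i + 1) (j + 1))) := by
  rw [map_mul, toFactor_pp hi hj, arrow_eq_mu]
  exact toFactor_aeval_mul q hi _

theorem toFactor_surjective : Function.Surjective (toFactor k n) := by
  intro x
  obtain ⟨a, rfl⟩ := toAbar_surjective x
  have h1 : a = ∑ i : Fin n, ∑ j : Fin n, e k n i * a * e k n j := by
    simp only [← Finset.mul_sum, sum_e, mul_one]
    rw [← Finset.sum_mul, sum_e, one_mul]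
  change _ ∈ (toFactor k n).range
  rw [h1, map_sum]
  refine Subalgebra.sum_mem _ fun i _ ↦ ?_
  rw [map_sum]
  refine Subalgebra.sum_mem _ fun j _ ↦ ?_
  rw [e_mul_mul_e]
  generalize (LinearMap.proj j ∘ₗ a.toEnd ∘ₗ _ : Ind k n (i + 1) →ₗ[Lam k n] Ind k n (j + 1)) = h
  by_cases hi : (i : ℕ) + 1 < n
  · by_cases hj : (j : ℕ) + 1 < n
    · obtain ⟨q, rfl⟩ := exists_eq_smul_can j.2 h
      exact ⟨_, toFactor_aeval_mul_pp q hi hj⟩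
    · rw [toAbar_mu_of_right_eq (by omega)]
      exact Subalgebra.zero_mem _
  · rw [toAbar_mu_of_left_eq (by omega)]
    exact Subalgebra.zero_mem _

theorem toFactor_injective : Function.Injective (toFactor k n) := by
  rw [injective_iff_map_eq_zero]
  intro w hw
  refine eq_zero_of_pv_mul_mul_pv fun i hi j hj ↦ ?_
  have h0 : toFactor k n (pv k (n - 1) i * w * pv k (n - 1) j) = 0 := by
    rw [map_mul, map_mul, hw, mul_zero, zero_mul]
  obtain ⟨q, hq⟩ := exists_pv_mul_mul_pv w i j
  rw [hq] at h0 ⊢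
  rw [toFactor_aeval_mul_pp q (by omega) (by omega), toAbar_eq_zero_iff] at h0
  -- The ideal is tested on the generator of [i+1], killed by x^(i+1): its image in [j+1] must be a
  -- multiple of x^(n-i-1).
  have h1 : xbar k n ^ (i + 1) • (Pi.single ⟨i, by omega⟩ 1 : E k n) = 0 := by
    rw [← Pi.single_smul, Ind.pow_smul le_rfl, Pi.single_zero]
  obtain ⟨z, hz⟩ := exists_toEnd_eq_of_mem_idealTop h0 _ h1
  have hz' := congrFun hz ⟨j, by omega⟩
  rw [mu_toEnd, Pi.single_eq_same, Pi.single_eq_same, LinearMap.smul_apply, Pi.smul_apply,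
    can_one] at hz'
  obtain ⟨p, hp⟩ := Ind.exists_smul (z ⟨j, by omega⟩)
  rw [hp, xbar_pow_smul, xbar_pow_smul, smul_smul, smul_smul, ← map_mul, ← map_mul, ← sub_eq_zero,
    ← sub_smul, ← map_sub, Ind.smul_one_eq_zero_iff (show j + 1 ≤ n by omega)] at hz'
  have h2 : (Polynomial.X : Polynomial k) ^ min (j + 1) (n - (i + 1)) ∣
      q * Polynomial.X ^ (j + 1 - (i + 1)) :=
    (dvd_sub_left ((pow_dvd_pow _ (min_le_right _ _)).mul_right p)).1
      ((pow_dvd_pow _ (min_le_left _ _)).trans hz')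
  -- After removing the shift of the canonical map, the exponent is min(i+1, n-1-j) if i ≤ j, and
  -- min(j+1, n-1-i) otherwise. By `pz_pow_mul_pp` with m = n-1, this power of z kills the shortest
  -- path.
  have h3 : (Polynomial.X : Polynomial k) ^ (min (j + 1) (n - (i + 1)) - (j - i)) ∣ q := by
    have h4 : min (j + 1) (n - (i + 1)) =
        (min (j + 1) (n - (i + 1)) - (j - i)) + (j + 1 - (i + 1)) := by omega
    rw [h4, pow_add] at h2
    exact (mul_dvd_mul_iff_right (pow_ne_zero _ Polynomial.X_ne_zero)).1 h2
  obtain ⟨r, rfl⟩ := h3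
  rw [mul_comm, map_mul, map_pow, Polynomial.aeval_X, mul_assoc, pz_pow_mul_pp (by omega), mul_zero]

variable (k n) in
/-- The standard isomorphism `Π_{n-1} ≅ A_n/⟨e(n)⟩`. -/
def factorEquiv : Preproj k (n - 1) ≃ₐ[k] Abar k n :=
  AlgEquiv.ofBijective (toFactor k n) ⟨toFactor_injective, toFactor_surjective⟩

theorem isStandard_factorEquiv : IsStandard (factorEquiv k n) :=
  ⟨fun _ ↦ toFactor_gen _, fun _ ↦ toFactor_gen _, fun _ ↦ toFactor_gen _⟩

/-! ### Projective modules -/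

theorem torsionlessFin_P {d : ℕ} (hd : d ≤ n) : torsionlessFin k n (ModuleCat.of _ (P k n d)) :=
  have := finite_P (k := k) hd
  ⟨finLen_of_finite, isTorsionless_homE⟩

variable (k n) in
/-- The embedding `P(j+1) → A_n` given by the inclusion of `[j+1]` into `E`. -/
def PToA (j : Fin n) : P k n (j + 1) →ₗ[A k n] A k n :=
  (homESelf k n).toLinearMap ∘ₗ
    HomE.map (LinearMap.single (Lam k n) (fun l : Fin n ↦ Ind k n (l + 1)) j)

omit [NeZero n] in
theorem PToA_mul_e (j : Fin n) (h : P k n (j + 1)) : PToA k n j h * e k n j = PToA k n j h := by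
  apply A.toEnd_injective
  refine LinearMap.ext fun y ↦ ?_
  change (Pi.single j ((Pi.single j (h.ap y) : E k n) j) : E k n) = Pi.single j (h.ap y)
  rw [Pi.single_eq_same]

omit [NeZero n] in
theorem exists_PToA_eq (j : Fin n) (a : A k n) : ∃ h, PToA k n j h = a * e k n j :=
  ⟨(LinearMap.proj j ∘ₗ a.toEnd : E k n →ₗ[Lam k n] Ind k n (j + 1)), rfl⟩

omit [NeZero n] in
theorem PToA_smul (j : Fin n) (h : P k n (j + 1)) : PToA k n j h •
    (id (LinearMap.proj j : E k n →ₗ[Lam k n] Ind k n (j + 1)) : P k n (j + 1)) = h := by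
  refine HomE.ext fun y ↦ ?_
  change (Pi.single j (h.ap y) : E k n) j = h.ap y
  rw [Pi.single_eq_same]

/-- The element of A_n attached to h carries the projection E → [j+1] to h, and ⟨e(n)⟩ acts as zero
modulo torsion. Conversely torsion is generated by the elements e(n)m, whose images are left
multiples by e(n). -/
theorem PToA_mem_idealTop_iff (j : Fin n) (h : P k n (j + 1)) :
    PToA k n j h ∈ idealTop k n ↔ h ∈ tors k n (P k n (j + 1)) := by
  constructor
  · intro H
    rw [← PToA_smul j h, ← Submodule.Quotient.mk_eq_zero, Submodule.Quotient.mk_smul]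
    exact isTorsionBySet_tors k n (P k n (j + 1)) (a := ⟨_, H⟩)
  · intro H
    have : tors k n (P k n (j + 1)) ≤ Submodule.comap (PToA k n j) (idealTop k n) := by
      refine tors_le fun m ↦ ?_
      rw [Submodule.mem_comap, map_smul, smul_eq_mul, ← toAbar_eq_zero_iff, map_mul, toAbar_e_top,
        zero_mul]
    exact this H

/-- `PToA` identifies P(j+1) with the left ideal of A_n generated by the idempotent of [j+1].
Reducing modulo ⟨e(n)⟩ maps it onto the left ideal of Π_{n-1} at vertex j, with kernel the torsion
submodule. -/
theorem nonempty_deltaPi_P_iso {φ : Preproj k (n - 1) ≃ₐ[k] Abar k n} (hφ : IsStandard φ)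
    (j : Fin (n - 1)) (hP : torsionlessFin k n (ModuleCat.of _ (P k n (j + 1)))) :
    Nonempty (((deltaPi φ).obj ⟨_, hP⟩).obj ≅ ModuleCat.of _ (PPi k (n - 1) j)) := by
  have hv : φ.symm (toAbar k n (e k n (vtx j))) = Preproj.gen k (n - 1) (.vert j) := by
    rw [← hφ.1, AlgEquiv.symm_apply_apply]
  let F : P k n (j + 1) →ₗ[A k n] A k n := PToA k n (vtx j)
  have hF : ∀ h, φ.symm (toAbar k n (F h)) ∈ PPi k (n - 1) j := fun h ↦ by
    have h1 : F h = F h * e k n (vtx j) := (PToA_mul_e (vtx j) h).symm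
    rw [h1, map_mul, map_mul, hv]
    exact Ideal.mul_mem_left _ _ (Ideal.subset_span rfl)
  let g : P k n (j + 1) →+ PPi k (n - 1) j :=
    { toFun := fun h ↦ ⟨φ.symm (toAbar k n (F h)), hF h⟩
      map_zero' := Subtype.ext (by
        change φ.symm (toAbar k n (F 0)) = 0
        rw [map_zero, map_zero, map_zero])
      map_add' := fun h h' ↦ Subtype.ext (by
        change φ.symm (toAbar k n (F (h + h'))) = φ.symm (toAbar k n (F h)) +
          φ.symm (toAbar k n (F h'))
        rw [map_add, map_add, map_add]) }
  refine ⟨deltaPiIso φ ⟨_, hP⟩ (PPi k (n - 1) j) g ?_ ?_ ?_⟩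
  · rintro ⟨p, hp⟩
    obtain ⟨p', rfl⟩ := Ideal.mem_span_singleton'.1 hp
    obtain ⟨a, ha⟩ := toAbar_surjective (φ p')
    obtain ⟨h, hh⟩ := exists_PToA_eq (vtx j) a
    refine ⟨h, Subtype.ext ?_⟩
    change φ.symm (toAbar k n (PToA k n (vtx j) h)) = _
    rw [hh, map_mul, map_mul, hv, ha, AlgEquiv.symm_apply_apply]
  · intro a h
    refine Subtype.ext ?_
    change φ.symm (toAbar k n (F (a • id h : P k n (j + 1)))) =
      φ.symm (toAbar k n a) * φ.symm (toAbar k n (F h))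
    rw [map_smul, smul_eq_mul, map_mul, map_mul]
    rfl
  · intro h
    refine Subtype.ext_iff.trans ?_
    exact (EmbeddingLike.map_eq_zero_iff (f := φ.symm)).trans
      ((toAbar_eq_zero_iff _).trans (PToA_mem_idealTop_iff (vtx j) h))

end Iso

end PreprojQuot

end

/-! ### The main theorem -/

theorem proposition5 (k : Type u) [Field k] (n : ℕ) [NeZero n] :
    ∃ φ : PreprojQuot.Preproj k (n - 1) ≃ₐ[k] PreprojQuot.Abar k n,
      PreprojQuot.IsStandard φ ∧
      (∃ (hT : PreprojQuot.torsionlessFin k n (ModuleCat.of _ (PreprojQuot.T k n)))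
        (hδ : ∀ (X Y : PreprojQuot.FCat k n) (f g : X ⟶ Y),
          PreprojQuot.idealRel (ObjectProperty.singleton ⟨_, hT⟩) f g →
            (PreprojQuot.deltaPi φ).map f = (PreprojQuot.deltaPi φ).map g),
        (CategoryTheory.Quotient.lift _ (PreprojQuot.deltaPi φ) hδ :
          PreprojQuot.FactorCategory (ObjectProperty.singleton ⟨_, hT⟩) ⥤
            PreprojQuot.FinMod (PreprojQuot.Preproj k (n - 1))).IsEquivalence) ∧
      ∀ j : Fin (n - 1),
        ∃ hP : PreprojQuot.torsionlessFin k n (ModuleCat.of _ (PreprojQuot.P k n (j + 1))),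
          Nonempty (((PreprojQuot.deltaPi φ).obj ⟨_, hP⟩).obj ≅
            ModuleCat.of _ (PreprojQuot.PPi k (n - 1) j)) := by
  let φ := PreprojQuot.factorEquiv k n
  refine ⟨φ, PreprojQuot.isStandard_factorEquiv, ⟨PreprojQuot.torsionlessFin_T k n,
    fun X Y f g h ↦ (PreprojQuot.deltaPi_map_eq_iff_idealRel φ f g).2 h,
    PreprojQuot.isEquivalence_lift φ _⟩, fun j ↦ ?_⟩
  have hP := PreprojQuot.torsionlessFin_P (k := k) (n := n) (d := j + 1) (by omega)
  exact ⟨hP, PreprojQuot.nonempty_deltaPi_P_iso PreprojQuot.isStandard_factorEquiv j hP⟩
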